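/- Let $\Lambda$, $\Gamma$ and $\mu$ be one of the following, with $g\ge 2$. (a) $\Gamma\subset \mathrm{PSL}_2(\mathbb C)$ is a Schottky group of rank $g$ with standard free generators $\gamma_1,\dots,\gamma_g$ (there are $2g$ pairwise disjoint closed topological discs in $\mathbb P^1(\mathbb C)$, grouped in $g$ pairs, such that $\gamma_i$ maps the exterior of one disc of the $i$-th pair onto the interior of the other), $\Lambda\subset\mathbb P^1(\mathbb C)$ is its limit set, and $\mu$ is its Patterson–Sullivan probability measure with respect to a base point $x_0$ of hyperbolic 3-space. (b) $X$ is a finite connected unoriented graph (loops and multiple edges are allowed) with first Betti number $g$ and all vertex valencies $\ge 3$, $T$ is its universal covering tree, $\Gamma$ is the free group of rank $g$ acting freely on $T$ with quotient $X$, with a chosen system of free generators, $\Lambda=\partial T$, and $\mu$ is the Patterson–Sullivan probability measure on $\Lambda$ with respect to a base vertex $x_0$ of $T$. In both cases $\mu$ is the probability measure that is conformal of dimension $\delta$, i.e. $\mu(\gamma E)=\int_E e^{\delta B(x_0,\gamma^{-1}x_0,\xi)}\,d\mu(\xi)$ for all $\gamma\in\Gamma$ and all Borel sets $E\subset\Lambda$,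 where $\delta$ is the critical exponent of $\sum_{\gamma\in\Gamma} e^{-s\,d(x_0,\gamma x_0)}$ and $B(x,y,\xi)=\lim_{p\to\xi}\big(d(x,p)-d(y,p)\big)$. Points of $\Lambda$ correspond to infinite reduced words in the generators of $\Gamma$ and their inverses. For a finite word $w$ let $\Lambda(w)\subset\Lambda$ be the clopen set of the points whose infinite word starts with $w$. Let $\mathcal A^\infty$ be the involutive algebra of locally constant functions $\Lambda\to\mathbb C$, and let $\mathcal H$ be the completion of $\mathcal A^\infty$ in the norm $\|f\|^2=\int_\Lambda|f|^2\,d\mu$, on which $\mathcal A^\infty$ acts by multiplication operators $\pi(a)$. Let $\mathcal H_n^\infty$ be the linear span of the characteristic functions $1_{\Lambda(w)}$ of the words $w$ of length $\le n$, let $P_n$ be the orthogonal projection of $\mathcal H$ onto $\mathcal H_n^\infty$, let $Q_0=P_0$ and $Q_n=P_n-P_{n-1}$ for $n\ge1$, let $\lambda_n=(\dim\mathcal H_n^\infty)^3$, and let $|D|=\sum_{n\ge0}\lambda_nQ_n$, a positive unbounded operator on $\mathcal H$. Then there are no sign $F$ (a bounded operator with $F=F^*$ and $F^2=1$ that commutes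 with $|D|$) and $\mathbb Z/2$-grading $\epsilon$ (a bounded operator with $\epsilon=\epsilon^*$ and $\epsilon^2=1$) such that, for $D=F|D|$, the triple $(\mathcal A^\infty,\mathcal H,D)$ is a spectral triple that is even with respect to $\epsilon$, i.e. such that $D=D^*$ has compact resolvent, all commutators $[\pi(a),D]$ with $a\in\mathcal A^\infty$ are bounded, $\epsilon\pi(a)=\pi(a)\epsilon$ for all $a\in\mathcal A^\infty$, and $D\epsilon=-\epsilon D$. In particular there is none with a non-trivial sign $F$. -/

import Mathlib

open Filter Topology MeasureTheory
open scoped ENNReal MatrixGroups BoundedContinuousFunction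

noncomputable section

namespace CantorTriple

/-! ## Spectral triples, signs and gradings -/

section Abstract

variable {A H : Type*} [Ring A] [StarRing A] [Algebra ℂ A]
  [NormedAddCommGroup H] [InnerProductSpace ℂ H] [CompleteSpace H]

/-- `(A, H, D)` is a spectral triple, for the involutive algebra `A` represented on `H` by `π`
and the (unbounded) operator `D`. -/
structure IsSpectralTriple (π : A →⋆ₐ[ℂ] (H →L[ℂ] H)) (D : H →ₗ.[ℂ] H) : Prop where
  separable : TopologicalSpace.SeparableSpace H
  dense_domain : Dense (D.domain : Set H)
  selfAdjoint : IsSelfAdjoint D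
  /-- Compact resolvent: the positive operator `R = (1 + D ^ 2) ^ (-1/2)` is compact. -/
  compact_resolvent : ∃ R : H →L[ℂ] H, R.IsPositive ∧ IsCompactOperator R ∧
    ∀ ψ : H, ∃ (h₁ : R (R ψ) ∈ D.domain) (h₂ : D ⟨R (R ψ), h₁⟩ ∈ D.domain),
      R (R ψ) + D ⟨D ⟨R (R ψ), h₁⟩, h₂⟩ = ψ
  /-- The commutators `[D, π a]` are (densely defined and) bounded. -/
  bounded_commutator : ∀ a : A, ∃ C : ℝ, ∀ ψ : D.domain,
    ∃ h : π a (ψ : H) ∈ D.domain, ‖D ⟨π a (ψ : H), h⟩ - π a (D ψ)‖ ≤ C * ‖(ψ : H)‖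

/-- `ε` is a `ℤ/2`-grading of `H` making the spectral triple `(A, H, D)` even: a self-adjoint
involution commuting with the algebra and anticommuting with `D`. -/
structure IsEvenGrading (π : A →⋆ₐ[ℂ] (H →L[ℂ] H)) (D : H →ₗ.[ℂ] H) (ε : H →L[ℂ] H) :
    Prop where
  selfAdjoint : IsSelfAdjoint ε
  sq_eq_one : ε * ε = 1
  commute : ∀ a : A, ε * π a = π a * ε
  anticommute : ∀ ψ : D.domain, ∃ h : ε (ψ : H) ∈ D.domain, D ⟨ε (ψ : H), h⟩ = -ε (D ψ)

/-- `F` is a sign for the positive operator `T`: a self-adjoint involution such that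
`F T = T F`, so that `D = F T` has polar decomposition `D = T F` with `|D| = T`. -/
structure IsSign (T : H →ₗ.[ℂ] H) (F : H →L[ℂ] H) : Prop where
  selfAdjoint : IsSelfAdjoint F
  sq_eq_one : F * F = 1
  commute : ∀ ψ : T.domain, ∃ h : F (ψ : H) ∈ T.domain, T ⟨F (ψ : H), h⟩ = F (T ψ)

/-- The operator `D = F T`, with the same domain as `T`. -/
def signed (F : H →L[ℂ] H) (T : H →ₗ.[ℂ] H) : H →ₗ.[ℂ] H where
  domain := T.domain
  toFun := F.toLinearMap ∘ₗ T.toFun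

/-- The unbounded operator `∑ λ_n Q_n`, defined on all `ψ ∈ H` for which the series `∑ λ_n Q_n ψ`
converges (for pairwise orthogonal projections `Q_n`, this means `∑ λ_n² ‖Q_n ψ‖² < ∞`). -/
def diagOp (l : ℕ → ℝ) (Q : ℕ → (H →L[ℂ] H)) : H →ₗ.[ℂ] H where
  domain :=
    { carrier := {ψ | Summable fun n => (l n : ℂ) • Q n ψ}
      add_mem' := fun {ψ φ} hψ hφ => by
        have h : Summable fun n => (l n : ℂ) • Q n ψ + (l n : ℂ) • Q n φ := Summable.add hψ hφ
        simpa only [Set.mem_ofPred_eq, map_add, smul_add] using h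
      zero_mem' := by
        simpa only [Set.mem_ofPred_eq, map_zero, smul_zero] using summable_zero
      smul_mem' := fun c ψ hψ => by
        have h : Summable fun n => c • (l n : ℂ) • Q n ψ := Summable.const_smul c hψ
        simpa only [Set.mem_ofPred_eq, map_smul, smul_comm c] using h }
  toFun :=
    { toFun := fun ψ => ∑' n, (l n : ℂ) • Q n (ψ : H)
      map_add' := fun ψ φ => by
        rw [← Summable.tsum_add ψ.2 φ.2]
        simp only [Submodule.coe_add, map_add, smul_add]
      map_smul' := fun c ψ => by
        rw [RingHom.id_apply, ← Summable.tsum_const_smul c ψ.2]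
        simp only [Submodule.coe_smul, map_smul, smul_comm c] }

end Abstract

/-! ## The algebra of locally constant functions, its `L²`-completion and the operator `|D|` -/

section Construction

variable {Λ : Type*} [TopologicalSpace Λ]

variable (Λ) in
/-- The involutive algebra `A^∞ = C(Λ, ℤ) ⊗ ℂ` of locally constant complex functions
(on a compact `Λ` these are all bounded). -/
def locConst : StarSubalgebra ℂ (Λ →ᵇ ℂ) where
  carrier := {f | IsLocallyConstant f}
  mul_mem' hf hg := by
    simpa using! IsLocallyConstant.mul hf hg
  add_mem' hf hg := by
    simpa using! IsLocallyConstant.add hf hg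
  algebraMap_mem' c := IsLocallyConstant.const c
  star_mem' hf := IsLocallyConstant.comp hf star

/-- `H_n^∞`, the linear span of the characteristic functions `1_{Λ(w)}` of the (clopen) sets
`Λ(w) = cyl w`, over the words `w` of length at most `n`. -/
def wordSpan {S : Type*} (cyl : List S → Set Λ) (n : ℕ) : Submodule ℂ (locConst Λ) :=
  Submodule.span ℂ {f | ∃ w : List S, w.length ≤ n ∧
    ∀ x, (f : Λ →ᵇ ℂ) x = (cyl w).indicator (fun _ => (1 : ℂ)) x}

/-- The eigenvalue `λ_n = (dim H_n^∞) ^ 3`. -/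
def eigval {S : Type*} (cyl : List S → Set Λ) (n : ℕ) : ℝ :=
  (Module.finrank ℂ (wordSpan cyl n) : ℝ) ^ 3

instance {S : Type*} [Finite S] (cyl : List S → Set Λ) (n : ℕ) :
    Module.Finite ℂ (wordSpan cyl n) := by
  refine FiniteDimensional.span_of_finite ℂ ?_
  refine Set.Finite.subset ((List.finite_length_le S n).biUnion
    (t := fun w => {f : locConst Λ |
      ∀ x, (f : Λ →ᵇ ℂ) x = (cyl w).indicator (fun _ => (1 : ℂ)) x}) ?_) ?_
  · intro w _
    refine Set.Subsingleton.finite ?_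
    intro f hf g hg
    ext x
    rw [hf x, hg x]
  · rintro f ⟨w, hw, hf⟩
    simp only [Set.mem_iUnion]
    exact ⟨w, hw, hf⟩

variable [MeasurableSpace Λ] [BorelSpace Λ] (μ : Measure Λ) [IsFiniteMeasure μ]

/-- The canonical map `A^∞ → L²(Λ, μ)`. -/
def toL2 : locConst Λ →ₗ[ℂ] Lp ℂ 2 μ :=
  (BoundedContinuousFunction.toLp 2 μ ℂ).toLinearMap ∘ₗ
    (locConst Λ).toSubalgebra.toSubmodule.subtype

/-- The Hilbert space `H`: the completion of `A^∞` in the norm `‖f‖² = ∫ |f|² dμ`, realized as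
the closure of `A^∞` in `L²(Λ, μ)`. -/
def hilbert : Submodule ℂ (Lp ℂ 2 μ) := (LinearMap.range (toL2 μ)).topologicalClosure

instance : CompleteSpace (hilbert μ) :=
  (Submodule.isClosed_topologicalClosure _).completeSpace_coe

/-- The canonical map `A^∞ → H`. -/
def toHilbert : locConst Λ →ₗ[ℂ] hilbert μ :=
  (toL2 μ).codRestrict (hilbert μ)
    fun f => Submodule.le_topologicalClosure _ (LinearMap.mem_range_self _ f)

/-- Multiplication by a bounded continuous function on `L²(Λ, μ)`. -/
def mulL2 (a : Λ →ᵇ ℂ) : Lp ℂ 2 μ →L[ℂ] Lp ℂ 2 μ :=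
  (ContinuousLinearMap.mul ℂ ℂ).holderL μ ∞ 2 2 (BoundedContinuousFunction.toLp ∞ μ ℂ a)

theorem coeFn_mulL2 (a : Λ →ᵇ ℂ) (f : Lp ℂ 2 μ) :
    mulL2 μ a f =ᵐ[μ] fun x => a x * f x := by
  have h := (ContinuousLinearMap.mul ℂ ℂ).coeFn_holder (r := 2)
    (BoundedContinuousFunction.toLp ∞ μ ℂ a) f
  filter_upwards [h, BoundedContinuousFunction.coeFn_toLp (p := ∞) (𝕜 := ℂ) μ a] with x h1 h2
  rw [mulL2, ContinuousLinearMap.holderL_apply_apply, h1, h2]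
  rfl

theorem mulL2_toL2 (a b : locConst Λ) : mulL2 μ a (toL2 μ b) = toL2 μ (a * b) := by
  apply Lp.ext
  filter_upwards [coeFn_mulL2 μ a (toL2 μ b),
    BoundedContinuousFunction.coeFn_toLp (p := 2) (𝕜 := ℂ) μ (b : Λ →ᵇ ℂ),
    BoundedContinuousFunction.coeFn_toLp (p := 2) (𝕜 := ℂ) μ ((a * b : locConst Λ) : Λ →ᵇ ℂ)]
    with x h1 h2 h3
  rw [h1]
  refine Eq.trans ?_ h3.symm
  exact congrArg _ h2

theorem mulL2_mem (a : locConst Λ) {f : Lp ℂ 2 μ} (hf : f ∈ hilbert μ) :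
    mulL2 μ a f ∈ hilbert μ := by
  refine map_mem_closure (mulL2 μ (a : Λ →ᵇ ℂ)).continuous hf ?_
  rintro _ ⟨b, rfl⟩
  exact ⟨a * b, (mulL2_toL2 μ a b).symm⟩

/-- Multiplication by `a ∈ A^∞` on `H`. -/
def mulOp (a : locConst Λ) : hilbert μ →L[ℂ] hilbert μ :=
  ((mulL2 μ a).comp (hilbert μ).subtypeL).codRestrict (hilbert μ)
    fun f => mulL2_mem μ a f.2

theorem coeFn_mulOp (a : locConst Λ) (f : hilbert μ) :
    (mulOp μ a f : Lp ℂ 2 μ) =ᵐ[μ] fun x => (a : Λ →ᵇ ℂ) x * (f : Lp ℂ 2 μ) x :=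
  coeFn_mulL2 μ a f

/-- The representation of `A^∞` on `H` by multiplication operators. -/
def mulRep : locConst Λ →⋆ₐ[ℂ] (hilbert μ →L[ℂ] hilbert μ) where
  toFun := mulOp μ
  map_one' := by
    ext1 f
    apply Subtype.ext
    apply Lp.ext
    filter_upwards [coeFn_mulOp μ 1 f] with x h1
    rw [h1]
    simp
  map_mul' a b := by
    ext1 f
    apply Subtype.ext
    apply Lp.ext
    filter_upwards [coeFn_mulOp μ (a * b) f, coeFn_mulOp μ a (mulOp μ b f), coeFn_mulOp μ b f]
      with x h1 h2 h3
    rw [h1, mul_apply_eq_comp, h2, h3]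
    simp [mul_assoc]
  map_zero' := by
    ext1 f
    apply Subtype.ext
    apply Lp.ext
    filter_upwards [coeFn_mulOp μ 0 f, Lp.coeFn_zero ℂ 2 μ] with x h1 h2
    rw [h1]
    refine Eq.trans ?_ h2.symm
    simp
  map_add' a b := by
    ext1 f
    apply Subtype.ext
    apply Lp.ext
    filter_upwards [coeFn_mulOp μ (a + b) f, coeFn_mulOp μ a f, coeFn_mulOp μ b f,
      Lp.coeFn_add (mulOp μ a f : Lp ℂ 2 μ) (mulOp μ b f : Lp ℂ 2 μ)] with x h1 h2 h3 h4
    rw [h1]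
    refine Eq.trans ?_ h4.symm
    simp [h2, h3, add_mul]
  commutes' c := by
    ext1 f
    apply Subtype.ext
    apply Lp.ext
    filter_upwards [coeFn_mulOp μ (algebraMap ℂ (locConst Λ) c) f,
      Lp.coeFn_smul c (f : Lp ℂ 2 μ)] with x h1 h2
    rw [h1]
    refine Eq.trans ?_ h2.symm
    rfl
  map_star' a := by
    rw [ContinuousLinearMap.star_eq_adjoint, ContinuousLinearMap.eq_adjoint_iff]
    intro f g
    rw [Submodule.coe_inner, Submodule.coe_inner, L2.inner_def, L2.inner_def]
    apply integral_congr_ae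
    filter_upwards [coeFn_mulOp μ (star a) f, coeFn_mulOp μ a g] with x h1 h2
    rw [h1, h2]
    simp only [RCLike.inner_apply]
    have : ((star a : locConst Λ) : Λ →ᵇ ℂ) x = (starRingEnd ℂ) ((a : Λ →ᵇ ℂ) x) := rfl
    rw [this]
    simp
    ring

variable {S : Type*} [Finite S] (cyl : List S → Set Λ)

/-- The subspace `H_n^∞` of `H`. -/
def hilbertN (n : ℕ) : Submodule ℂ (hilbert μ) := (wordSpan cyl n).map (toHilbert μ)

instance (n : ℕ) : Module.Finite ℂ (hilbertN μ cyl n) :=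
  inferInstanceAs (Module.Finite ℂ ((wordSpan cyl n).map (toHilbert μ)))

/-- `P_n`, the orthogonal projection of `H` onto `H_n^∞`. -/
def projP (n : ℕ) : hilbert μ →L[ℂ] hilbert μ :=
  haveI : CompleteSpace (hilbertN μ cyl n) := FiniteDimensional.complete ℂ _
  (hilbertN μ cyl n).starProjection

/-- `Q_0 = P_0` and `Q_n = P_n - P_{n-1}` for `n ≥ 1`. -/
def projQ : ℕ → (hilbert μ →L[ℂ] hilbert μ)
  | 0 => projP μ cyl 0
  | n + 1 => projP μ cyl (n + 1) - projP μ cyl n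

/-- The unbounded operator `|D| = ∑ λ_n Q_n` on `H`. -/
def absD : hilbert μ →ₗ.[ℂ] hilbert μ := diagOp (eigval cyl) (projQ μ cyl)

/-- There are a sign `F` for `|D|` and a `ℤ/2`-grading `ε` such that `(A^∞, H, F |D|)`, with `A^∞`
acting by multiplication, is a spectral triple that is even with respect to `ε`. -/
def AdmitsEvenStructure : Prop :=
  ∃ F ε : hilbert μ →L[ℂ] hilbert μ,
    IsSign (absD μ cyl) F ∧
    IsSpectralTriple (mulRep μ) (signed F (absD μ cyl)) ∧
    IsEvenGrading (mulRep μ) (signed F (absD μ cyl)) ε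

end Construction

/-! ## Infinite reduced words -/

section Words

/-- Infinite reduced words in the letters `s_i = (i, true)` and `s_i⁻¹ = (i, false)`. -/
def InfWord (ι : Type*) : Type _ :=
  {ω : ℕ → ι × Bool // ∀ n, ω (n + 1) ≠ ((ω n).1, !(ω n).2)}

variable {ι : Type*}

/-- The group element `s_i` or `s_i⁻¹` denoted by a letter. -/
def letter {G : Type*} [Group G] (s : ι → G) (a : ι × Bool) : G :=
  if a.2 then s a.1 else (s a.1)⁻¹

/-- The product of the first `n` letters of an infinite word. -/
def prefixProd {G : Type*} [Group G] (s : ι → G) (ω : InfWord ι) : ℕ → G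
  | 0 => 1
  | n + 1 => prefixProd s ω n * letter s (ω.1 n)

/-- Given the relation "`ω` is the infinite word of the point `ξ`", the set `Λ(w)` of all points
given by infinite reduced words that start with the finite word `w`. -/
def cylinder {Λ : Type*} (codes : InfWord ι → Λ → Prop) (w : List (ι × Bool)) : Set Λ :=
  {ξ | ∃ ω : InfWord ι, (∀ i : Fin w.length, ω.1 i = w.get i) ∧ codes ω ξ}

end Words

/-! ## Schottky groups

Elements of `PSL₂(ℂ)` are represented by matrices in `SL₂(ℂ)`; only their actions on
`ℙ¹(ℂ) = ℂ ∪ {∞}` and on hyperbolic 3-space are used. -/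

section Schottky

/-- The action of `SL₂(ℂ)` on `ℙ¹(ℂ)` by Möbius transformations. -/
def moebius (A : SL(2, ℂ)) (z : OnePoint ℂ) : OnePoint ℂ :=
  (Matrix.SpecialLinearGroup.toGL A : GL (Fin 2) ℂ) • z

/-- `γ_1, …, γ_g` are the standard generators of a Schottky group: there are `2g` pairwise
disjoint closed topological discs in `ℙ¹(ℂ)`, paired by the `γ_i`, such that `γ_i` maps the
exterior of the first disc of the `i`-th pair onto the interior of the second. -/
def IsSchottky {g : ℕ} (γ : Fin g → SL(2, ℂ)) : Prop :=
  ∃ B : Fin g × Bool → Set (OnePoint ℂ),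
    (∀ a, Nonempty (B a ≃ₜ Metric.closedBall (0 : ℂ) 1)) ∧
    Pairwise (fun a b => Disjoint (B a) (B b)) ∧
    ∀ i, moebius (γ i) '' (B (i, false))ᶜ = interior (B (i, true))

/-- The limit set of `Γ`: all accumulation points of `Γ`-orbits in `ℙ¹(ℂ)`. -/
def limitSet (Γ : Subgroup SL(2, ℂ)) : Set (OnePoint ℂ) :=
  {ξ | ∃ z : OnePoint ℂ, MapClusterPt ξ cofinite fun A : Γ => moebius A z}

instance : MeasurableSpace (OnePoint ℂ) := borel _

instance : BorelSpace (OnePoint ℂ) := ⟨rfl⟩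

/-- The infinite reduced word `ω` in the generators `γ` denotes the limit point `ξ`: the images of
points outside the limit set under the initial subwords of `ω` converge to `ξ`. -/
def schottkyCodes {g : ℕ} (γ : Fin g → SL(2, ℂ)) (ω : InfWord (Fin g))
    (ξ : limitSet (Subgroup.closure (Set.range γ))) : Prop :=
  ∀ z ∉ limitSet (Subgroup.closure (Set.range γ)),
    Tendsto (fun n => moebius (prefixProd γ ω n) z) atTop (𝓝 (ξ : OnePoint ℂ))

/-- Hyperbolic 3-space, in the upper half-space model `{(z, t) : z ∈ ℂ, t > 0}`. -/
@[ext]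
structure Hyp3 where
  z : ℂ
  t : ℝ
  t_pos : 0 < t

namespace Hyp3

/-- The hyperbolic distance, of curvature `-1`. -/
def hdist (x y : Hyp3) : ℝ :=
  2 * Real.arsinh (√(‖x.z - y.z‖ ^ 2 + (x.t - y.t) ^ 2) / (2 * √(x.t * y.t)))

theorem denom_pos (A : SL(2, ℂ)) (x : Hyp3) :
    0 < ‖A 1 0 * x.z + A 1 1‖ ^ 2 + ‖A 1 0‖ ^ 2 * x.t ^ 2 := by
  have ht := x.t_pos
  by_cases h : A 1 0 = 0
  · have h1 : A 1 1 ≠ 0 := by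
      intro h1
      have hd := A.det_coe
      rw [Matrix.det_fin_two, h, h1] at hd
      simp at hd
    rw [h]
    have h2 : 0 < ‖A 1 1‖ := norm_pos_iff.mpr h1
    rw [zero_mul, zero_add]
    positivity
  · have : 0 < ‖A 1 0‖ := norm_pos_iff.mpr h
    positivity

/-- The isometric action of `SL₂(ℂ)` on hyperbolic 3-space (the Poincaré extension of its action
on `ℙ¹(ℂ)`). -/
def act (A : SL(2, ℂ)) (x : Hyp3) : Hyp3 where
  z := ((A 0 0 * x.z + A 0 1) * (starRingEnd ℂ) (A 1 0 * x.z + A 1 1) +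
      A 0 0 * (starRingEnd ℂ) (A 1 0) * (x.t : ℂ) ^ 2) /
    ((‖A 1 0 * x.z + A 1 1‖ ^ 2 + ‖A 1 0‖ ^ 2 * x.t ^ 2 : ℝ) : ℂ)
  t := x.t / (‖A 1 0 * x.z + A 1 1‖ ^ 2 + ‖A 1 0‖ ^ 2 * x.t ^ 2)
  t_pos := div_pos x.t_pos (denom_pos A x)

/-- A (vertical) geodesic converging to the boundary point `ξ`, at integer times. -/
def toward (ξ : OnePoint ℂ) (n : ℕ) : Hyp3 :=
  ξ.elim ⟨0, Real.exp n, Real.exp_pos _⟩ fun z => ⟨z, Real.exp (-n), Real.exp_pos _⟩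

/-- The Busemann function `B(x, y, ξ) = lim_{p → ξ} d(x, p) - d(y, p)`. -/
def busemann (x y : Hyp3) (ξ : OnePoint ℂ) : ℝ :=
  limUnder atTop fun n : ℕ => hdist x (toward ξ n) - hdist y (toward ξ n)

end Hyp3

/-- The critical exponent of the Poincaré series `∑_{A ∈ Γ} exp (-s d(x₀, A x₀))`. -/
def schottkyExponent (Γ : Subgroup SL(2, ℂ)) (x₀ : Hyp3) : ℝ :=
  sInf {s : ℝ | 0 ≤ s ∧ Summable fun A : Γ => Real.exp (-s * Hyp3.hdist x₀ (Hyp3.act A x₀))}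

/-- The probability measure `μ` on the limit set of `Γ` is the Patterson–Sullivan measure based
at `x₀`: it is conformal of dimension the critical exponent `δ`, that is,
`μ(A E) = ∫_E exp (δ B(x₀, A⁻¹ x₀, ξ)) dμ(ξ)` for all `A ∈ Γ` and all Borel sets `E`. -/
def IsSchottkyPS (Γ : Subgroup SL(2, ℂ)) (x₀ : Hyp3) (μ : Measure (limitSet Γ)) : Prop :=
  ∀ A ∈ Γ, ∀ E : Set (limitSet Γ), MeasurableSet E →
    μ {η | ∃ ξ ∈ E, moebius A (ξ : OnePoint ℂ) = η} =
      ∫⁻ ξ in E, ENNReal.ofReal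
        (Real.exp (schottkyExponent Γ x₀ * Hyp3.busemann x₀ (Hyp3.act A⁻¹ x₀) ξ)) ∂μ

end Schottky

/-! ## Graphs and their universal covering trees -/

section Graphs

/-- An unoriented graph, possibly with loops and multiple edges: `E` is the set of oriented
edges and `inv` reverses the orientation. -/
structure MultiGraph (V E : Type*) where
  src : E → V
  inv : E → E
  inv_inv : ∀ e, inv (inv e) = e
  inv_ne : ∀ e, inv e ≠ e

namespace MultiGraph

variable {V E : Type*} (X : MultiGraph V E)

/-- Any two vertices are joined by an edge path (and there is a vertex). -/
def Connected : Prop :=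
  Nonempty V ∧ ∀ u v, Relation.ReflTransGen (fun a b => ∃ e, X.src e = a ∧ X.src (X.inv e) = b) u v

/-- The valency of a vertex (a loop counts twice). -/
def valency (v : V) : ℕ := Nat.card {e // X.src e = v}

/-- The first Betti number of a finite connected graph: number of unoriented edges minus number of
vertices plus one. -/
def betti (_ : MultiGraph V E) : ℤ := (Nat.card E : ℤ) / 2 - Nat.card V + 1

end MultiGraph

/-- The group `Γ` acts freely by automorphisms on the simplicial graph `T` with quotient the
graph `X`; the quotient map is `p` on vertices and `q` on oriented edges. If `T` is a tree,
this says that `T` is the universal covering tree of `X` and `Γ` its group of deck transformations,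
i.e. the fundamental group of `X`. -/
structure IsFreeQuotient {W V E : Type*} (T : SimpleGraph W) (Γ : Subgroup (T ≃g T))
    (X : MultiGraph V E) (p : W → V) (q : T.Dart → E) : Prop where
  free : ∀ γ ∈ Γ, ∀ x, γ x = x → γ = 1
  src_edge : ∀ d : T.Dart, X.src (q d) = p d.fst
  inv_edge : ∀ d : T.Dart, X.inv (q d) = q d.symm
  surjective_vertex : Function.Surjective p
  surjective_edge : Function.Surjective q
  vertex_eq_iff : ∀ x y, p x = p y ↔ ∃ γ ∈ Γ, γ x = y
  edge_eq_iff : ∀ d e : T.Dart, q d = q e ↔ ∃ γ ∈ Γ, γ d.fst = e.fst ∧ γ d.snd = e.snd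

/-- The boundary `∂T` of the tree `T`: its ends, each represented by the unique infinite path
without backtracking that starts from the base vertex `x₀`. -/
def TreeBoundary {W : Type*} (T : SimpleGraph W) (x₀ : W) : Type _ :=
  {r : ℕ → W // r 0 = x₀ ∧ (∀ n, T.Adj (r n) (r (n + 1))) ∧ ∀ n, r (n + 2) ≠ r n}

variable {W : Type*} {T : SimpleGraph W} {x₀ : W}

/-- The topology of `∂T`, generated by the sets of all ends whose path passes through a given
vertex at a given time. -/
instance : TopologicalSpace (TreeBoundary T x₀) :=
  TopologicalSpace.generateFrom {U | ∃ n v, U = {r | r.1 n = v}}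

instance : MeasurableSpace (TreeBoundary T x₀) := borel _

instance : BorelSpace (TreeBoundary T x₀) := ⟨rfl⟩

/-- The infinite reduced word `ω` in the generators `s` denotes the end `ξ`: the images of the base
vertex under the initial subwords of `ω` converge to `ξ`, that is, the geodesics from `x₀` to these
vertices eventually pass through each given vertex of the path `ξ`. -/
def treeCodes {g : ℕ} (s : Fin g → (T ≃g T)) (ω : InfWord (Fin g)) (ξ : TreeBoundary T x₀) :
    Prop :=
  ∀ k : ℕ, ∀ᶠ n in atTop,
    T.dist x₀ (ξ.1 k) + T.dist (ξ.1 k) (prefixProd s ω n x₀) = T.dist x₀ (prefixProd s ω n x₀)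

/-- Two infinite paths define the same end: they coincide eventually, up to a shift. -/
def SameEnd (r r' : ℕ → W) : Prop := ∃ m k, ∀ n, r (m + n) = r' (k + n)

/-- The Busemann function `B(x, y, ξ) = lim_{v → ξ} d(x, v) - d(y, v)`. -/
def treeBusemann (x y : W) (ξ : TreeBoundary T x₀) : ℝ :=
  limUnder atTop fun n : ℕ => (T.dist x (ξ.1 n) : ℝ) - T.dist y (ξ.1 n)

/-- The critical exponent of the Poincaré series `∑_{γ ∈ Γ} exp (-s d(x₀, γ x₀))`. -/
def treeExponent (Γ : Subgroup (T ≃g T)) (x₀ : W) : ℝ :=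
  sInf {s : ℝ | 0 ≤ s ∧ Summable fun γ : Γ => Real.exp (-s * T.dist x₀ ((γ : T ≃g T) x₀))}

/-- The probability measure `μ` on `∂T` is the Patterson–Sullivan measure of `Γ` based at `x₀`: it
is conformal of dimension the critical exponent `δ`, that is,
`μ(γ E) = ∫_E exp (δ B(x₀, γ⁻¹ x₀, ξ)) dμ(ξ)` for all `γ ∈ Γ` and all Borel sets `E`. -/
def IsTreePS (Γ : Subgroup (T ≃g T)) (μ : Measure (TreeBoundary T x₀)) : Prop :=
  ∀ γ ∈ Γ, ∀ E : Set (TreeBoundary T x₀), MeasurableSet E →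
    μ {η | ∃ ξ ∈ E, SameEnd (fun n => γ (ξ.1 n)) η.1} =
      ∫⁻ ξ in E, ENNReal.ofReal
        (Real.exp (treeExponent Γ x₀ * treeBusemann x₀ (γ⁻¹ x₀) ξ)) ∂μ

end Graphs

end CantorTriple

end

open scoped MatrixGroups
open MeasureTheory CantorTriple

noncomputable section

namespace CantorTriple

/-! ## Signs and gradings on a simple eigenspace -/

section DiagOp

variable {H : Type*} [NormedAddCommGroup H] [InnerProductSpace ℂ H]
  {l : ℕ → ℝ} {Q : ℕ → (H →L[ℂ] H)}

/-! The obstruction sits in the lowest eigenspace of `|D|`. If `Λ([])` is all of `Λ`, then `H_0^∞`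
is the line of constants, so `λ_0 = 1`; an `n ≥ 1` with `λ_n = 1` has `H_n^∞ = H_0^∞`, hence `Q_n =
0`. The eigenvalue `1` of `|D|` is therefore simple, spanned by a vector `e`. A sign preserves this
line: `F e = c e` with `c² = 1`, so `D e = c e`. A grading that anticommutes with `D` gives `D (ε e)
= -c (ε e)`; hence `ε e` is fixed by `|D|²` and equals `d e`. Then `D (ε e)` is both `c d e` and `-c
d e`, so `d = 0`, against `ε² = 1`. This is `not_anticommute_of_simple_eigenvalue`, applied in
`not_admitsEvenStructure`.

What remains is geometric: `Λ([])` consists of the points denoted by some infinite reduced word, so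
every point of `Λ` needs a word.

For Schottky groups the letters come from ping-pong: a limit point lies in the image of the exterior
of a disc under a letter, and stripping that letter and iterating gives an itinerary. That the
itinerary converges to the point rests on the convergence property: Möbius maps tending to infinity
have, along an ultrafilter, an attracting and a repelling point, obtained from a rank one limit of
rescaled matrices.

For trees, a ray is shadowed by an orbit of the free group. This gives a sequence with bounded steps
and lengths tending to infinity in the free group; its initial letters stabilize to an infinite
reduced word (`exists_infWord_of_coarse_path`), whose prefixes return near the ray arbitrarily far
out. -/

theorem hasSum_diagOp (ψ : (diagOp l Q).domain) :
    HasSum (fun n => (l n : ℂ) • Q n (ψ : H)) (diagOp l Q ψ) :=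
  Summable.hasSum ψ.2

theorem apply_diagOp (hQ : ∀ m n x, Q m (Q n x) = if m = n then Q n x else 0) (m : ℕ)
    (ψ : (diagOp l Q).domain) : Q m (diagOp l Q ψ) = (l m : ℂ) • Q m (ψ : H) := by
  have h := (hasSum_diagOp ψ).mapL (Q m)
  refine h.unique ?_
  convert hasSum_ite_eq m ((l m : ℂ) • Q m (ψ : H)) using 2 with n
  rw [map_smul, hQ]
  by_cases hmn : m = n
  · subst hmn; simp
  · rw [if_neg hmn, if_neg (Ne.symm hmn), smul_zero]

theorem diagOp_eq_of_forall_eq_zero (ψ : (diagOp l Q).domain)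
    (h : ∀ n, n ≠ 0 → Q n (ψ : H) = 0) : diagOp l Q ψ = (l 0 : ℂ) • Q 0 (ψ : H) := by
  refine (hasSum_diagOp ψ).unique ?_
  refine hasSum_single (f := fun n => (l n : ℂ) • Q n (ψ : H)) 0 fun n hn => ?_
  simp only [h n hn, smul_zero]

/-- If the eigenvalue `1` of `diagOp l Q` occurs only at the index `0`, then every `ψ` fixed by the
square of `diagOp l Q` lies in the range of `Q 0`. -/
theorem mem_range_of_diagOp_diagOp_eq
    (hQ : ∀ m n x, Q m (Q n x) = if m = n then Q n x else 0)
    (hl0 : ∀ n, 0 ≤ l n) (hl1 : ∀ n, n ≠ 0 → l n = 1 → Q n = 0)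
    {ψ φ : (diagOp l Q).domain} (h₁ : diagOp l Q ψ = φ) (h₂ : diagOp l Q φ = ψ) :
    ∃ x, (ψ : H) = Q 0 x := by
  -- Comparing `Q n`-components gives `(1 - l n ^ 2) Q n φ = 0`, and `l n ≥ 0` leaves only `l n = 1`
  -- as an exception.
  have key : ∀ n, n ≠ 0 → Q n (φ : H) = 0 := by
    intro n hn
    by_cases hln : l n = 1
    · rw [hl1 n hn hln]; rfl
    have e₁ := apply_diagOp hQ n ψ
    have e₂ := apply_diagOp hQ n φ
    rw [h₁] at e₁
    rw [h₂] at e₂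
    rw [e₂, smul_smul] at e₁
    have h3 : (1 - (l n : ℂ) * l n) • Q n (φ : H) = 0 := by
      rw [sub_smul, one_smul, ← e₁, sub_self]
    refine (smul_eq_zero.mp h3).resolve_left fun h4 => hln ?_
    have h5 : l n * l n = 1 := by
      have : (l n : ℂ) * l n = 1 := (sub_eq_zero.mp h4).symm
      exact_mod_cast this
    nlinarith [hl0 n]
  -- Expanding `ψ` as the image of `φ` avoids having to know that the `Q n` sum to the identity.
  refine ⟨(l 0 : ℂ) • (φ : H), ?_⟩
  rw [← h₂, diagOp_eq_of_forall_eq_zero φ key, map_smul]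

/-- A positive operator with an isolated simple eigenvalue has no sign that anticommutes with a
grading. -/
theorem not_anticommute_of_simple_eigenvalue [CompleteSpace H]
    (hQ : ∀ m n x, Q m (Q n x) = if m = n then Q n x else 0)
    (hl0 : ∀ n, 0 ≤ l n) (hl1 : ∀ n, n ≠ 0 → l n = 1 → Q n = 0) (hl : l 0 = 1)
    {e : H} (he : e ≠ 0) (hQe : Q 0 e = e) (hrange : ∀ x, Q 0 x ∈ Submodule.span ℂ {e})
    {F ε : H →L[ℂ] H} (hF : IsSign (diagOp l Q) F) (hε : ε * ε = 1)
    (hanti : ∀ ψ : (diagOp l Q).domain, ∃ h : ε (ψ : H) ∈ (diagOp l Q).domain,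
      F (diagOp l Q ⟨ε (ψ : H), h⟩) = -ε (F (diagOp l Q ψ))) : False := by
  have hspan : ∀ {ψ φ : (diagOp l Q).domain}, diagOp l Q ψ = φ → diagOp l Q φ = ψ →
      ∃ c : ℂ, (ψ : H) = c • e := by
    intro ψ φ h₁ h₂
    obtain ⟨x, hx⟩ := mem_range_of_diagOp_diagOp_eq hQ hl0 hl1 h₁ h₂
    obtain ⟨c, hc⟩ := Submodule.mem_span_singleton.mp (hrange x)
    exact ⟨c, hx.trans hc.symm⟩
  have hQne : ∀ n, n ≠ 0 → Q n e = 0 := fun n hn => by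
    rw [← hQe, hQ, if_neg hn]
  have hedom : e ∈ (diagOp l Q).domain := by
    refine (hasSum_single (f := fun n => (l n : ℂ) • Q n e) 0 fun n hn => ?_).summable
    simp only [hQne n hn, smul_zero]
  set e' : (diagOp l Q).domain := ⟨e, hedom⟩ with he'
  have hTe : diagOp l Q e' = e := by
    rw [diagOp_eq_of_forall_eq_zero e' hQne, hl]
    simpa using hQe
  have hFF : ∀ x, F (F x) = x := fun x => congrArg (fun G : H →L[ℂ] H => G x) hF.sq_eq_one
  have hεε : ∀ x, ε (ε x) = x := fun x => congrArg (fun G : H →L[ℂ] H => G x) hε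
  obtain ⟨hFe, hTFe⟩ := hF.commute e'
  rw [hTe] at hTFe
  obtain ⟨c, hc⟩ := hspan (ψ := ⟨F e, hFe⟩) (φ := ⟨F e, hFe⟩) hTFe hTFe
  obtain ⟨hεe, hTεe⟩ := hanti e'
  rw [hTe] at hTεe
  -- Anticommutation determines `F T (ε e)`; one more `F` recovers `T (ε e)`, where `T` is the
  -- diagonal operator.
  have hTε : diagOp l Q ⟨ε e, hεe⟩ = -(c • F (ε e)) := by
    rw [← hFF (diagOp l Q _), hTεe]
    simp only at hc
    rw [hc, map_smul, map_neg, map_smul]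
  obtain ⟨hFεe, hTFεe⟩ := hF.commute ⟨ε e, hεe⟩
  have hcc : c * c = 1 := by
    have h1 := hFF e
    simp only at hc
    rw [hc, map_smul, hc, smul_smul] at h1
    have h2 : (c * c - 1) • e = 0 := by rw [sub_smul, one_smul, h1, sub_self]
    exact sub_eq_zero.mp ((smul_eq_zero.mp h2).resolve_right he)
  rw [hTε, map_neg, map_smul, hFF] at hTFεe
  -- `T` exchanges `ε e` and `-c F (ε e)`, because `c² = 1`. Thus `ε e` is fixed by `T²`.
  obtain ⟨d, hd⟩ := hspan (ψ := ⟨ε e, hεe⟩) (φ := -(c • ⟨F (ε e), hFεe⟩))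
    (by rw [hTε]; rfl) (by
      rw [LinearPMap.map_neg, LinearPMap.map_smul, hTFεe, smul_neg, neg_neg, smul_smul, hcc,
        one_smul])
  simp only at hc hd
  have h1 : diagOp l Q ⟨ε e, hεe⟩ = d • e := by
    have : (⟨ε e, hεe⟩ : (diagOp l Q).domain) = d • e' := Subtype.ext hd
    rw [this, LinearPMap.map_smul, hTe]
  rw [h1, map_smul, hc, map_smul, hd, smul_smul, smul_smul] at hTεe
  have h2 : (2 * (d * c)) • e = 0 := by
    rw [two_mul, add_smul]
    nth_rewrite 1 [hTεe]
    rw [mul_comm d c, neg_add_cancel]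
  have h3 : d * c = 0 := by
    simpa using (smul_eq_zero.mp h2).resolve_right he
  rcases mul_eq_zero.mp h3 with h | h
  · have h4 := hεε e
    rw [hd, h, zero_smul, map_zero] at h4
    exact he h4.symm
  · rw [h] at hcc; simp at hcc

end DiagOp

/-! ## The operator `|D|` of a family of cylinders that covers the whole space -/

section Cylinders

variable {Λ : Type*} [TopologicalSpace Λ] {S : Type*} (cyl : List S → Set Λ)

theorem wordSpan_mono {m n : ℕ} (h : m ≤ n) : wordSpan cyl m ≤ wordSpan cyl n :=
  Submodule.span_mono fun _ ⟨w, hw, hf⟩ => ⟨w, hw.trans h, hf⟩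

theorem wordSpan_zero (hcyl : cyl [] = Set.univ) : wordSpan cyl 0 = Submodule.span ℂ {1} := by
  refine congrArg (Submodule.span ℂ) (Set.ext fun f => ?_)
  constructor
  · rintro ⟨w, hw, hf⟩
    obtain rfl : w = [] := List.length_eq_zero_iff.mp (Nat.le_zero.mp hw)
    refine Subtype.ext (BoundedContinuousFunction.ext fun x => ?_)
    rw [hf x, hcyl]
    simp
  · rintro rfl
    refine ⟨[], le_rfl, fun x => ?_⟩
    rw [hcyl]
    simp

theorem finrank_wordSpan_zero [Nonempty Λ] (hcyl : cyl [] = Set.univ) :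
    Module.finrank ℂ (wordSpan cyl 0) = 1 := by
  rw [wordSpan_zero cyl hcyl]
  refine finrank_span_singleton fun h => ?_
  obtain ⟨x⟩ := ‹Nonempty Λ›
  have := congrArg (fun f : locConst Λ => (f : Λ →ᵇ ℂ) x) h
  simp at this

/-- A cube equal to `1` forces dimension `1`, and `wordSpan cyl 0` already has that dimension, so
the increasing chain is constant up to `n`. This is what makes the eigenvalue `1` simple. -/
theorem wordSpan_eq_of_eigval_eq_one [Finite S] [Nonempty Λ] (hcyl : cyl [] = Set.univ) {n : ℕ}
    (hn : eigval cyl n = 1) {m : ℕ} (hm : m ≤ n) : wordSpan cyl m = wordSpan cyl n := by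
  have h1 : Module.finrank ℂ (wordSpan cyl n) = 1 := by
    have h2 : ((Module.finrank ℂ (wordSpan cyl n) : ℝ)) ^ 3 = 1 := hn
    have h3 : (Module.finrank ℂ (wordSpan cyl n)) ^ 3 = 1 := by exact_mod_cast h2
    exact (Nat.pow_eq_one.mp h3).resolve_right (by norm_num)
  have h0 : wordSpan cyl 0 = wordSpan cyl n :=
    Submodule.eq_of_le_of_finrank_eq (wordSpan_mono cyl n.zero_le)
      ((finrank_wordSpan_zero cyl hcyl).trans h1.symm)
  exact le_antisymm (wordSpan_mono cyl hm) (h0 ▸ wordSpan_mono cyl m.zero_le)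

variable [MeasurableSpace Λ] [BorelSpace Λ] (μ : Measure Λ) [IsFiniteMeasure μ]

theorem hilbertN_mono {m n : ℕ} (h : m ≤ n) : hilbertN μ cyl m ≤ hilbertN μ cyl n :=
  Submodule.map_mono (wordSpan_mono cyl h)

theorem hilbertN_zero (hcyl : cyl [] = Set.univ) :
    hilbertN μ cyl 0 = Submodule.span ℂ {toHilbert μ 1} := by
  rw [hilbertN, wordSpan_zero cyl hcyl, Submodule.map_span, Set.image_singleton]

variable [Finite S]

theorem projP_projP {m n : ℕ} (x : hilbert μ) :
    projP μ cyl m (projP μ cyl n x) = projP μ cyl (min m n) x := by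
  have : ∀ n, CompleteSpace (hilbertN μ cyl n) := fun n => FiniteDimensional.complete ℂ _
  rcases le_total m n with h | h
  · rw [min_eq_left h]
    exact congrArg (fun G : hilbert μ →L[ℂ] hilbert μ => G x)
      (Submodule.starProjection_comp_starProjection_of_le (hilbertN_mono cyl μ h))
  · rw [min_eq_right h]
    exact Submodule.starProjection_eq_self_iff.mpr
      (hilbertN_mono cyl μ h (Submodule.starProjection_apply_mem _ x))

theorem projQ_projQ (m n : ℕ) (x : hilbert μ) :
    projQ μ cyl m (projQ μ cyl n x) = if m = n then projQ μ cyl n x else 0 := by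
  rcases m with _ | m <;> rcases n with _ | n <;>
    simp only [projQ, _root_.sub_apply, map_sub, projP_projP]
  · simp
  · simp
  · simp
  · rcases lt_trichotomy m n with h | h | h
    · rw [min_eq_left (by omega), min_eq_left (by omega), min_eq_left (by omega),
        min_eq_left (by omega), if_neg (by omega)]
      simp
    · subst h
      simp
    · rw [min_eq_right (by omega), min_eq_right (by omega), min_eq_right (by omega),
        min_eq_right (by omega), if_neg (by omega)]
      simp

theorem toHilbert_one_ne_zero [NeZero μ] : toHilbert μ 1 ≠ 0 := by
  intro h
  have h1 : toL2 μ 1 = 0 := congrArg Subtype.val h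
  have h2 := BoundedContinuousFunction.coeFn_toLp (p := 2) (𝕜 := ℂ) μ ((1 : locConst Λ) : Λ →ᵇ ℂ)
  have h3 : ∀ᵐ x ∂μ, False := by
    filter_upwards [h2, Lp.coeFn_zero ℂ 2 μ] with x hx hx0
    have h4 : (toL2 μ 1 : Lp ℂ 2 μ) x = ((1 : locConst Λ) : Λ →ᵇ ℂ) x := hx
    rw [h1, hx0] at h4
    simp at h4
  exact h3.exists.elim fun _ h => h

/-- The triple admits no even structure as soon as the cylinder of the empty word is everything:
the lowest eigenspace of `|D|` then consists of the constant functions. -/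
theorem not_admitsEvenStructure [NeZero μ] (hcyl : cyl [] = Set.univ) :
    ¬ AdmitsEvenStructure μ cyl := by
  rintro ⟨F, ε, hF, -, hε⟩
  have : ∀ n, CompleteSpace (hilbertN μ cyl n) := fun n => FiniteDimensional.complete ℂ _
  have : Nonempty Λ := μ.nonempty_of_neZero
  refine not_anticommute_of_simple_eigenvalue (projQ_projQ cyl μ) (fun n => by
    unfold eigval; positivity) ?_ ?_ (toHilbert_one_ne_zero μ) ?_ ?_ hF hε.sq_eq_one
    hε.anticommute
  · rintro (_ | n) hn h
    · exact absurd rfl hn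
    · have h1 : hilbertN μ cyl n = hilbertN μ cyl (n + 1) :=
        congrArg (Submodule.map (toHilbert μ))
          (wordSpan_eq_of_eigval_eq_one cyl hcyl h n.le_succ)
      have h2 : projP μ cyl n = projP μ cyl (n + 1) := by
        unfold projP
        congr 1
      rw [projQ, h2, sub_self]
  · rw [eigval, finrank_wordSpan_zero cyl hcyl]
    norm_num
  · refine Submodule.starProjection_eq_self_iff.mpr ?_
    rw [hilbertN_zero cyl μ hcyl]
    exact Submodule.mem_span_singleton_self _
  · intro x
    rw [← hilbertN_zero cyl μ hcyl]
    exact Submodule.starProjection_apply_mem _ x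

end Cylinders

/-! ## Homogeneous coordinates on `ℙ¹(ℂ)` -/

section Homogeneous

open Matrix

/-- The point of `ℙ¹(ℂ)` with homogeneous coordinates `v`. -/
def ofVec (v : Fin 2 → ℂ) : OnePoint ℂ :=
  if v 1 = 0 then OnePoint.infty else ((v 0 / v 1 : ℂ) : OnePoint ℂ)

theorem ofVec_smul {c : ℂ} (hc : c ≠ 0) (v : Fin 2 → ℂ) : ofVec (c • v) = ofVec v := by
  simp only [ofVec, Pi.smul_apply, smul_eq_mul, mul_eq_zero, hc, false_or]
  rw [mul_div_mul_left _ _ hc]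

theorem fin_two_ne_zero {v : Fin 2 → ℂ} : v ≠ 0 ↔ v 0 ≠ 0 ∨ v 1 ≠ 0 := by
  rw [Ne, funext_iff, Fin.forall_fin_two, not_and_or]
  rfl

theorem ofVec_eq_of_cross {v w : Fin 2 → ℂ} (hv : v ≠ 0) (hw : w ≠ 0)
    (h : v 0 * w 1 = v 1 * w 0) : ofVec v = ofVec w := by
  unfold ofVec
  rw [fin_two_ne_zero] at hv hw
  by_cases h1 : v 1 = 0
  · have h2 : w 1 = 0 := by
      rw [h1, zero_mul] at h
      exact (mul_eq_zero.mp h).resolve_left (hv.resolve_right (not_not.mpr h1))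
    rw [if_pos h1, if_pos h2]
  · have h2 : w 1 ≠ 0 := by
      intro h2
      rw [h2, mul_zero, eq_comm] at h
      exact (mul_ne_zero h1 (hw.resolve_right (not_not.mpr h2))) h
    rw [if_neg h1, if_neg h2, (div_eq_div_iff h1 h2).mpr (by rw [h, mul_comm])]

theorem exists_ofVec_eq (z : OnePoint ℂ) : ∃ v : Fin 2 → ℂ, ‖v‖ = 1 ∧ ofVec v = z := by
  obtain ⟨v, hv, hz⟩ : ∃ v : Fin 2 → ℂ, v ≠ 0 ∧ ofVec v = z := by
    induction z with
    | infty => exact ⟨![1, 0], by simp, by simp [ofVec]⟩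
    | coe z => exact ⟨![z, 1], by simp, by simp [ofVec]⟩
  have hn : ‖v‖ ≠ 0 := norm_ne_zero_iff.mpr hv
  refine ⟨((‖v‖⁻¹ : ℝ) : ℂ) • v, ?_, ?_⟩
  · rw [norm_smul, Complex.norm_real, norm_inv, norm_norm, inv_mul_cancel₀ hn]
  · rw [ofVec_smul (by exact_mod_cast inv_ne_zero hn), hz]

theorem continuousAt_ofVec {v : Fin 2 → ℂ} (hv : v ≠ 0) : ContinuousAt ofVec v := by
  by_cases h1 : v 1 = 0
  · have h0 : v 0 ≠ 0 := (fin_two_ne_zero.mp hv).resolve_right (not_not.mpr h1)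
    have hinf : ofVec v = OnePoint.infty := if_pos h1
    rw [ContinuousAt, hinf]
    refine OnePoint.le_nhds_infty.mpr fun K _ hK => ?_
    obtain ⟨R, hR⟩ := hK.isBounded.exists_norm_le
    have hcont : Continuous fun w : Fin 2 → ℂ => ‖w 0‖ - R * ‖w 1‖ := by fun_prop
    have hev : ∀ᶠ w in 𝓝 v, 0 < ‖w 0‖ - R * ‖w 1‖ := by
      refine hcont.continuousAt.eventually (lt_mem_nhds ?_)
      simpa [h1] using h0
    rw [← OnePoint.compl_image_coe, Filter.mem_map]
    -- The condition `‖w 0‖ > R ‖w 1‖` is open and keeps the quotient `w 0 / w 1` out of the ball of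
    -- radius `R` that contains `K`.
    filter_upwards [hev] with w hw
    rintro ⟨z, hz, hzw⟩
    unfold ofVec at hzw
    split_ifs at hzw with hw1
    · exact OnePoint.coe_ne_infty z hzw
    · rw [OnePoint.coe_eq_coe] at hzw
      have h2 := hR z hz
      rw [hzw, norm_div, div_le_iff₀ (norm_pos_iff.mpr hw1)] at h2
      linarith
  · have hev : ∀ᶠ w : Fin 2 → ℂ in 𝓝 v, w 1 ≠ 0 :=
      (continuous_apply 1).continuousAt.eventually_ne h1
    have : (fun w : Fin 2 → ℂ => ((w 0 / w 1 : ℂ) : OnePoint ℂ)) =ᶠ[𝓝 v] ofVec := by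
      filter_upwards [hev] with w hw
      rw [ofVec, if_neg hw]
    refine ContinuousAt.congr ?_ this
    exact OnePoint.continuous_coe.continuousAt.comp
      ((continuous_apply 0).continuousAt.div (continuous_apply 1).continuousAt h1)

/-- Representatives can be taken on the compact unit sphere, so they converge along the ultrafilter
to a nonzero vector. Limits in the projective line thus become limits of vectors, on which matrices
act continuously. -/
theorem exists_tendsto_lift {ι : Type*} (U : Ultrafilter ι) {z : ι → OnePoint ℂ} {η : OnePoint ℂ}
    (hz : Tendsto z U (𝓝 η)) : ∃ (v : ι → Fin 2 → ℂ) (w : Fin 2 → ℂ),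
      (∀ i, v i ≠ 0 ∧ ofVec (v i) = z i) ∧ Tendsto v U (𝓝 w) ∧ w ≠ 0 ∧ ofVec w = η := by
  choose v hv hvz using fun i => exists_ofVec_eq (z i)
  have hmem : ∀ᶠ x in (U.map v : Filter (Fin 2 → ℂ)), x ∈ Metric.sphere (0 : Fin 2 → ℂ) 1 :=
    Filter.Eventually.of_forall (f := (U : Filter ι)) fun i => by simp [hv i]
  obtain ⟨w, hw, hle⟩ := (isCompact_sphere (0 : Fin 2 → ℂ) 1).ultrafilter_le_nhds' (U.map v) hmem
  have hw0 : w ≠ 0 := ne_zero_of_mem_unit_sphere ⟨w, hw⟩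
  have hvw : Tendsto v U (𝓝 w) := hle
  refine ⟨v, w, fun i => ⟨fun h => ?_, hvz i⟩, hvw, hw0, ?_⟩
  · have := hv i
    rw [h, norm_zero] at this
    exact zero_ne_one this
  · have h2 : Tendsto (fun i => ofVec (v i)) U (𝓝 (ofVec w)) :=
      (continuousAt_ofVec hw0).tendsto.comp hvw
    simp only [hvz] at h2
    exact tendsto_nhds_unique h2 hz

theorem moebius_ofVec (A : SL(2, ℂ)) {v : Fin 2 → ℂ} (hv : v ≠ 0) :
    moebius A (ofVec v) = ofVec ((A : Matrix (Fin 2) (Fin 2) ℂ) *ᵥ v) := by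
  have hdet := A.det_coe
  rw [Matrix.det_fin_two] at hdet
  rw [fin_two_ne_zero] at hv
  unfold moebius ofVec
  by_cases h1 : v 1 = 0
  · have h0 := hv.resolve_right (not_not.mpr h1)
    rw [if_pos h1, OnePoint.smul_infty_eq_ite]
    by_cases hc : A 1 0 = 0 <;> simp [h1, h0, hc, mul_div_mul_right]
  · rw [if_neg h1, OnePoint.smul_some_eq_ite]
    have h2 : A 1 0 * (v 0 / v 1) + A 1 1 = (A 1 0 * v 0 + A 1 1 * v 1) / v 1 := by
      field_simp
    have h3 : A 0 0 * (v 0 / v 1) + A 0 1 = (A 0 0 * v 0 + A 0 1 * v 1) / v 1 := by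
      field_simp
    simp [h2, h3, h1, div_div_div_cancel_right₀]

theorem moebius_mul (A B : SL(2, ℂ)) (z : OnePoint ℂ) :
    moebius (A * B) z = moebius A (moebius B z) := by
  simp [moebius, mul_smul]

theorem moebius_one (z : OnePoint ℂ) : moebius 1 z = z := by
  simp [moebius]

theorem moebius_inv_moebius (A : SL(2, ℂ)) (z : OnePoint ℂ) : moebius A⁻¹ (moebius A z) = z := by
  rw [← moebius_mul, inv_mul_cancel, moebius_one]

theorem moebius_moebius_inv (A : SL(2, ℂ)) (z : OnePoint ℂ) : moebius A (moebius A⁻¹ z) = z := by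
  rw [← moebius_mul, mul_inv_cancel, moebius_one]

theorem mulVec_ne_zero (A : SL(2, ℂ)) {v : Fin 2 → ℂ} (hv : v ≠ 0) :
    (A : Matrix (Fin 2) (Fin 2) ℂ) *ᵥ v ≠ 0 := by
  intro h
  apply hv
  have h2 : ((A⁻¹ * A : SL(2, ℂ)) : Matrix (Fin 2) (Fin 2) ℂ) *ᵥ v = 0 := by
    rw [Matrix.SpecialLinearGroup.coe_mul, ← Matrix.mulVec_mulVec, h, Matrix.mulVec_zero]
  simpa using h2

theorem tendsto_moebius {ι : Type*} {U : Ultrafilter ι} {A : ι → SL(2, ℂ)} {B : SL(2, ℂ)}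
    (hA : Tendsto A U (𝓝 B)) {z : ι → OnePoint ℂ} {η : OnePoint ℂ} (hz : Tendsto z U (𝓝 η)) :
    Tendsto (fun i => moebius (A i) (z i)) U (𝓝 (moebius B η)) := by
  obtain ⟨v, w, hv, hvw, hw, rfl⟩ := exists_tendsto_lift U hz
  rw [moebius_ofVec B hw]
  have h1 : Tendsto (fun i => (A i : Matrix (Fin 2) (Fin 2) ℂ) *ᵥ v i) U
      (𝓝 ((B : Matrix (Fin 2) (Fin 2) ℂ) *ᵥ w)) := by
    have hc : Continuous fun p : Matrix (Fin 2) (Fin 2) ℂ × (Fin 2 → ℂ) => p.1 *ᵥ p.2 :=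
      continuous_fst.matrix_mulVec continuous_snd
    exact (hc.tendsto _).comp
      (((continuous_subtype_val.tendsto B).comp hA).prodMk_nhds hvw)
  refine ((continuousAt_ofVec (mulVec_ne_zero B hw)).tendsto.comp h1).congr fun i => ?_
  rw [Function.comp_apply, ← moebius_ofVec _ (hv i).1, (hv i).2]

theorem continuous_moebius (A : SL(2, ℂ)) : Continuous (moebius A) :=
  continuous_iff_ultrafilter.mpr fun _ _ hg =>
    tendsto_moebius (tendsto_const_nhds (x := A)) (tendsto_id.mono_left hg)

/-- The homeomorphism of `ℙ¹(ℂ)` given by a Möbius transformation. -/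
def moebiusHomeo (A : SL(2, ℂ)) : OnePoint ℂ ≃ₜ OnePoint ℂ where
  toFun := moebius A
  invFun := moebius A⁻¹
  left_inv := moebius_inv_moebius A
  right_inv := moebius_moebius_inv A
  continuous_toFun := continuous_moebius A
  continuous_invFun := continuous_moebius A⁻¹

/-- If multiples of the matrices `A i` tend to a matrix `p qᵀ` of rank one, then the transformations
`A i` tend to the constant `p`, locally uniformly off the kernel of `qᵀ`. -/
theorem tendsto_moebius_of_rank_one {ι : Type*} (U : Ultrafilter ι) {A : ι → SL(2, ℂ)}
    {c : ι → ℂ} (hc : ∀ᶠ i in (U : Filter ι), c i ≠ 0) {p q : Fin 2 → ℂ} (hp : p ≠ 0) (hq : q ≠ 0)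
    (hA : Tendsto (fun i => c i • (A i : Matrix (Fin 2) (Fin 2) ℂ)) U (𝓝 (vecMulVec p q)))
    {z : ι → OnePoint ℂ} {η : OnePoint ℂ} (hz : Tendsto z U (𝓝 η)) (hη : η ≠ ofVec ![-q 1, q 0]) :
    Tendsto (fun i => moebius (A i) (z i)) U (𝓝 (ofVec p)) := by
  obtain ⟨v, w, hv, hvw, hw, rfl⟩ := exists_tendsto_lift U hz
  have hqw : q ⬝ᵥ w ≠ 0 := by
    intro h
    refine hη (ofVec_eq_of_cross hw ?_ ?_)
    · rw [fin_two_ne_zero] at hq ⊢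
      simpa [or_comm] using hq
    · simp only [dotProduct, Fin.sum_univ_two] at h
      simp only [Matrix.cons_val_zero, Matrix.cons_val_one]
      linear_combination h
  have h1 : Tendsto (fun i => (c i • (A i : Matrix (Fin 2) (Fin 2) ℂ)) *ᵥ v i) U
      (𝓝 ((q ⬝ᵥ w) • p)) := by
    have hcont : Continuous fun p : Matrix (Fin 2) (Fin 2) ℂ × (Fin 2 → ℂ) => p.1 *ᵥ p.2 :=
      continuous_fst.matrix_mulVec continuous_snd
    have h2 := (hcont.tendsto _).comp (hA.prodMk_nhds hvw)
    have h3 : vecMulVec p q *ᵥ w = (q ⬝ᵥ w) • p := by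
      rw [Matrix.vecMulVec_mulVec]; ext i; simp [mul_comm]
    simp only at h2
    rw [h3] at h2
    exact h2
  rw [← ofVec_smul hqw p]
  refine ((continuousAt_ofVec (smul_ne_zero hqw hp)).tendsto.comp h1).congr' ?_
  filter_upwards [hc] with i hi
  rw [Function.comp_apply, Matrix.smul_mulVec, ofVec_smul hi, ← moebius_ofVec _ (hv i).1,
    (hv i).2]

theorem exists_eq_vecMulVec {M : Matrix (Fin 2) (Fin 2) ℂ} (h0 : M ≠ 0) (hdet : M.det = 0) :
    ∃ p q : Fin 2 → ℂ, p ≠ 0 ∧ q ≠ 0 ∧ M = vecMulVec p q := by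
  obtain ⟨j, k, hjk⟩ : ∃ j k, M j k ≠ 0 := by
    by_contra! h
    exact h0 (Matrix.ext h)
  -- Column `k` times row `j`, divided by the pivot `M j k`; the vanishing determinant supplies the
  -- one entry that is not immediate.
  refine ⟨fun i => M i k, fun i => M j i / M j k, fun h => hjk (congrFun h j), fun h => ?_, ?_⟩
  · have := congrFun h k
    simp [hjk] at this
  · rw [Matrix.det_fin_two] at hdet
    ext a b
    rw [Matrix.vecMulVec_apply, mul_div_assoc', eq_div_iff hjk]
    fin_cases j <;> fin_cases k <;> fin_cases a <;> fin_cases b <;>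
      simp only [Fin.mk_zero, Fin.mk_one, Fin.isValue] <;>
      first | ring1 | linear_combination hdet | linear_combination -hdet

/-- The convergence property: a family of Möbius transformations whose matrices tend to infinity
along an ultrafilter has an attracting point `a` and a repelling point `r`. -/
theorem exists_attracting_repelling {ι : Type*} (U : Ultrafilter ι) (A : ι → SL(2, ℂ))
    (hA : ∀ R : ℝ, ∀ᶠ i in (U : Filter ι), ∃ j k, R < ‖A i j k‖) :
    ∃ a r : OnePoint ℂ,
      (∀ (z : ι → OnePoint ℂ) (η : OnePoint ℂ), Tendsto z U (𝓝 η) → η ≠ r →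
        Tendsto (fun i => moebius (A i) (z i)) U (𝓝 a)) ∧
      (∀ (z : ι → OnePoint ℂ) (η : OnePoint ℂ), Tendsto z U (𝓝 η) → η ≠ a →
        Tendsto (fun i => moebius (A i)⁻¹ (z i)) U (𝓝 r)) := by
  let N : ι → ℝ := fun i => ‖fun j k => A i j k‖
  have hle : ∀ i j k, ‖A i j k‖ ≤ N i := fun i j k =>
    (norm_le_pi_norm (fun k => A i j k) k).trans (norm_le_pi_norm (fun j k => A i j k) j)
  have hN : Tendsto N U atTop := tendsto_atTop.mpr fun R => by
    filter_upwards [hA R] with i ⟨j, k, h⟩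
    exact h.le.trans (hle i j k)
  have hNpos : ∀ᶠ i in (U : Filter ι), 0 < N i := hN.eventually_gt_atTop 0
  let c : ι → ℂ := fun i => ((N i)⁻¹ : ℝ)
  have hc : ∀ᶠ i in (U : Filter ι), c i ≠ 0 := by
    filter_upwards [hNpos] with i hi
    exact Complex.ofReal_ne_zero.mpr (inv_pos.mpr hi).ne'
  have hc0 : Tendsto c U (𝓝 0) := by
    have := (Complex.continuous_ofReal.tendsto 0).comp hN.inv_tendsto_atTop
    simpa using! this
  let B : ι → (Fin 2 → Fin 2 → ℂ) := fun i j k => c i * A i j k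
  have hmem : ∀ᶠ x in (U.map B : Filter (Fin 2 → Fin 2 → ℂ)),
      x ∈ Metric.sphere (0 : Fin 2 → Fin 2 → ℂ) 1 := by
    have : ∀ᶠ i in (U : Filter ι), B i ∈ Metric.sphere (0 : Fin 2 → Fin 2 → ℂ) 1 := by
      filter_upwards [hNpos] with i hi
      have : B i = c i • fun j k => A i j k := rfl
      rw [mem_sphere_zero_iff_norm, this, norm_smul, Complex.norm_real, norm_inv,
        Real.norm_of_nonneg hi.le, inv_mul_cancel₀ hi.ne']
    exact this
  obtain ⟨M, hM, hBM⟩ := (isCompact_sphere (0 : Fin 2 → Fin 2 → ℂ) 1).ultrafilter_le_nhds'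
    (U.map B) hmem
  have hM0 : Matrix.of M ≠ 0 := ne_zero_of_mem_unit_sphere ⟨M, hM⟩
  have hBM' : Tendsto (fun i => c i • (A i : Matrix (Fin 2) (Fin 2) ℂ)) U (𝓝 (Matrix.of M)) := hBM
  -- The rescaled matrices have determinant `c i ^ 2 → 0`, while their norm stays `1`: the limit has
  -- rank exactly one.
  have hdet : (Matrix.of M).det = 0 := by
    have h1 := ((continuous_id.matrix_det (R := ℂ)).tendsto (Matrix.of M)).comp hBM'
    have h2 : Tendsto (fun i => c i ^ 2) U (𝓝 (0 ^ 2)) := hc0.pow 2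
    rw [zero_pow two_ne_zero] at h2
    refine tendsto_nhds_unique h1 (h2.congr fun i => ?_)
    simp
  obtain ⟨p, q, hp, hq, hpq⟩ := exists_eq_vecMulVec hM0 hdet
  rw [hpq] at hBM'
  refine ⟨ofVec p, ofVec ![-q 1, q 0], fun z η hz hη =>
    tendsto_moebius_of_rank_one U hc hp hq hBM' hz hη, fun z η hz hη => ?_⟩
  -- The inverse in `SL₂` is the adjugate, which is linear on 2×2 matrices. The same scalars
  -- therefore work, and taking the adjugate of `p qᵀ` swaps the attracting and repelling points.
  have hinv : Tendsto (fun i => c i • ((A i)⁻¹.1 : Matrix (Fin 2) (Fin 2) ℂ)) U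
      (𝓝 (vecMulVec ![-q 1, q 0] ![-p 1, p 0])) := by
    have h1 := ((continuous_id.matrix_adjugate (R := ℂ)).tendsto (vecMulVec p q)).comp hBM'
    have h2 : (vecMulVec p q).adjugate = vecMulVec ![-q 1, q 0] ![-p 1, p 0] := by
      rw [Matrix.adjugate_fin_two]
      ext j k
      fin_cases j <;> fin_cases k <;> simp [Matrix.vecMulVec_apply, mul_comm]
    simp only [id] at h1
    rw [h2] at h1
    refine h1.congr fun i => ?_
    simp [Matrix.adjugate_smul]
  rw [fin_two_ne_zero] at hp hq
  refine tendsto_moebius_of_rank_one U hc ?_ ?_ hinv hz ?_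
  · rw [fin_two_ne_zero]; simpa [or_comm] using hq
  · rw [fin_two_ne_zero]; simpa [or_comm] using hp
  · have h1 : (![-(![-p 1, p 0] : Fin 2 → ℂ) 1, (![-p 1, p 0] : Fin 2 → ℂ) 0] : Fin 2 → ℂ)
        = (-1 : ℂ) • p := by
      ext j; fin_cases j <;> simp
    rwa [h1, ofVec_smul (by norm_num)]

end Homogeneous

/-! ## Words in the generators of a group -/

section Letters

variable {ι G : Type*} [Group G]

/-- The inverse letter. -/
def invLetter (a : ι × Bool) : ι × Bool := (a.1, !a.2)

theorem invLetter_invLetter (a : ι × Bool) : invLetter (invLetter a) = a := by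
  simp [invLetter]

theorem letter_invLetter (s : ι → G) (a : ι × Bool) : letter s (invLetter a) = (letter s a)⁻¹ := by
  rcases a with ⟨i, _ | _⟩ <;> simp [invLetter, letter]

theorem letter_mem_closure (s : ι → G) (a : ι × Bool) :
    letter s a ∈ Subgroup.closure (Set.range s) := by
  rcases a with ⟨i, _ | _⟩
  · exact inv_mem (Subgroup.subset_closure ⟨i, rfl⟩)
  · exact Subgroup.subset_closure ⟨i, rfl⟩

theorem prefixProd_mem_closure (s : ι → G) (ω : InfWord ι) (n : ℕ) :
    prefixProd s ω n ∈ Subgroup.closure (Set.range s) := by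
  induction n with
  | zero => exact one_mem _
  | succ n ih => exact mul_mem ih (letter_mem_closure s _)

theorem lift_mk_cons (s : ι → G) (a : ι × Bool) (L : List (ι × Bool)) :
    FreeGroup.lift s (FreeGroup.mk (a :: L)) = letter s a * FreeGroup.lift s (FreeGroup.mk L) := by
  rcases a with ⟨i, _ | _⟩ <;> simp [FreeGroup.lift_mk, letter]

theorem exists_isReduced_of_mem_closure [DecidableEq ι] (s : ι → G) {A : G}
    (hA : A ∈ Subgroup.closure (Set.range s)) :
    ∃ L : List (ι × Bool), FreeGroup.IsReduced L ∧ FreeGroup.lift s (FreeGroup.mk L) = A := by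
  rw [← FreeGroup.range_lift_eq_closure] at hA
  obtain ⟨x, rfl⟩ := hA
  exact ⟨x.toWord, FreeGroup.isReduced_toWord, by rw [FreeGroup.mk_toWord]⟩

theorem ne_invLetter_of_isReduced_cons_cons {a b : ι × Bool} {L : List (ι × Bool)}
    (h : FreeGroup.IsReduced (a :: b :: L)) : b ≠ invLetter a := by
  rintro rfl
  have := (FreeGroup.isReduced_cons_cons.mp h).1 rfl
  simp [invLetter] at this

end Letters

/-! ## Ping-pong for Schottky groups -/

section PingPong

variable {g : ℕ} {γ : Fin g → SL(2, ℂ)} {B : Fin g × Bool → Set (OnePoint ℂ)}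

/-- The set onto which the letter `a` maps the exterior of the disc of the inverse letter. -/
def pingSet (γ : Fin g → SL(2, ℂ)) (B : Fin g × Bool → Set (OnePoint ℂ)) (a : Fin g × Bool) :
    Set (OnePoint ℂ) :=
  moebius (letter γ a) '' (B (invLetter a))ᶜ

/-- Disjoint closed nonempty sets that are paired by the transformations `γ i`. -/
structure IsPingPong (γ : Fin g → SL(2, ℂ)) (B : Fin g × Bool → Set (OnePoint ℂ)) : Prop where
  closed : ∀ a, IsClosed (B a)
  nonempty : ∀ a, (B a).Nonempty
  disjoint : Pairwise fun a b => Disjoint (B a) (B b)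
  pingSet_subset : ∀ a, pingSet γ B a ⊆ B a

theorem IsSchottky.exists_isPingPong (h : IsSchottky γ) : ∃ B, IsPingPong γ B := by
  obtain ⟨B, hB, hd, hγ⟩ := h
  refine ⟨B, fun a => ?_, fun a => ?_, hd, ?_⟩
  · obtain ⟨e⟩ := hB a
    have : CompactSpace (B a) := e.symm.compactSpace
    exact (isCompact_iff_compactSpace.mpr this).isClosed
  · obtain ⟨e⟩ := hB a
    exact ⟨_, (e.symm ⟨0, by simp⟩).2⟩
  · rintro ⟨i, _ | _⟩
    · rintro _ ⟨x, hx, rfl⟩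
      by_contra hnot
      have h1 : moebius (γ i) (moebius (γ i)⁻¹ x) ∈ interior (B (i, true)) :=
        hγ i ▸ Set.mem_image_of_mem _ hnot
      rw [moebius_moebius_inv] at h1
      exact hx (interior_subset h1)
    · exact (hγ i).trans_subset interior_subset

namespace IsPingPong

theorem notMem_of_mem (h : IsPingPong γ B)
    {a b : Fin g × Bool} (hab : a ≠ b) {x : OnePoint ℂ} (hx : x ∈ B a) :
    x ∉ B b :=
  Set.disjoint_left.mp (h.disjoint hab) hx

/-- The discs do not cover the sphere, since it is connected. -/
theorem exists_forall_notMem (h : IsPingPong γ B) (hg : 2 ≤ g) : ∃ z, ∀ a, z ∉ B a := by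
  by_contra! hcover
  let a : Fin g × Bool := (⟨0, by omega⟩, true)
  let b : Fin g × Bool := (⟨0, by omega⟩, false)
  have hab : a ≠ b := by simp [a, b]
  have hcompl : (B a)ᶜ = ⋃ c ∈ {c | c ≠ a}, B c := by
    ext x
    simp only [Set.mem_compl_iff, Set.mem_iUnion, exists_prop]
    constructor
    · intro hx
      obtain ⟨c, hc⟩ := hcover x
      exact ⟨c, fun hca => hx (hca ▸ hc), hc⟩
    · rintro ⟨c, hca, hc⟩
      exact h.notMem_of_mem hca hc
  have hopen : IsOpen (B a) := by
    rw [← isClosed_compl_iff, hcompl]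
    exact (Set.toFinite _).isClosed_biUnion fun c _ => h.closed c
  have huniv := IsClopen.eq_univ ⟨h.closed a, hopen⟩ (h.nonempty a)
  obtain ⟨x, hx⟩ := h.nonempty b
  exact h.notMem_of_mem hab (huniv ▸ Set.mem_univ x) hx

theorem isOpen_setOf_forall_notMem (h : IsPingPong γ B) :
    IsOpen {z | ∀ a, z ∉ B a} := by
  have : {z | ∀ a, z ∉ B a} = ⋂ a, (B a)ᶜ := by ext; simp
  rw [this]
  exact isOpen_iInter_of_finite fun a => (h.closed a).isOpen_compl

/-- The complement of the discs is open and nonempty, and the sphere has no isolated points. The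
freedom to avoid `w` is needed to choose a base point different from an attracting point. -/
theorem exists_ne_forall_notMem (h : IsPingPong γ B)
    (hg : 2 ≤ g) (w : OnePoint ℂ) : ∃ z, z ≠ w ∧ ∀ a, z ∉ B a := by
  obtain ⟨z, hz⟩ := h.exists_forall_notMem hg
  have h1 : ∀ᶠ x in 𝓝[≠] z, ∀ a, x ∉ B a :=
    mem_nhdsWithin_of_mem_nhds (h.isOpen_setOf_forall_notMem.mem_nhds hz)
  obtain ⟨y, hy, hyz⟩ := (h1.and self_mem_nhdsWithin).exists
  by_cases hzw : z = w
  · exact ⟨y, hzw ▸ hyz, hy⟩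
  · exact ⟨z, hzw, hz⟩

/-- A closed subset of `pingSet γ B a` that contains the images of `z` under all reduced words that
start with the letter `a`. -/
def trap (γ : Fin g → SL(2, ℂ)) (B : Fin g × Bool → Set (OnePoint ℂ)) (z : OnePoint ℂ)
    (a : Fin g × Bool) : Set (OnePoint ℂ) :=
  moebius (letter γ a) '' ({z} ∪ ⋃ b ∈ {b | b ≠ invLetter a}, B b)

theorem trap_subset_pingSet (h : IsPingPong γ B) {z : OnePoint ℂ} (hz : ∀ a, z ∉ B a)
    (a : Fin g × Bool) : trap γ B z a ⊆ pingSet γ B a := by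
  refine Set.image_mono ?_
  rintro x (rfl | hx)
  · exact hz _
  · simp only [Set.mem_iUnion] at hx
    obtain ⟨b, hb, hx⟩ := hx
    exact h.notMem_of_mem hb hx

/-- Closedness is the reason for using traps: `pingSet` is the image of an open set, so limits of
orbit points could otherwise escape to its boundary. -/
theorem isClosed_trap (h : IsPingPong γ B) {z : OnePoint ℂ}
    (a : Fin g × Bool) : IsClosed (trap γ B z a) :=
  (moebiusHomeo (letter γ a)).isClosedMap _
    (isClosed_singleton.union ((Set.toFinite _).isClosed_biUnion fun c _ => h.closed c))

theorem word_mem_trap (h : IsPingPong γ B) {z : OnePoint ℂ} (hz : ∀ a, z ∉ B a)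
    (L : List (Fin g × Bool)) (a : Fin g × Bool)
    (hL : FreeGroup.IsReduced (a :: L)) :
    moebius (FreeGroup.lift γ (FreeGroup.mk (a :: L))) z ∈ trap γ B z a := by
  rw [lift_mk_cons, moebius_mul]
  refine Set.mem_image_of_mem _ ?_
  cases L with
  | nil =>
    left
    simp [moebius_one]
  | cons b L =>
    right
    simp only [Set.mem_iUnion]
    refine ⟨b, ne_invLetter_of_isReduced_cons_cons hL, ?_⟩
    exact h.pingSet_subset b (h.trap_subset_pingSet hz b
      (h.word_mem_trap hz L b (FreeGroup.isReduced_cons_cons.mp hL).2))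

theorem exists_mem_trap (h : IsPingPong γ B) {z : OnePoint ℂ} (hz : ∀ a, z ∉ B a)
    {A : SL(2, ℂ)} (hA : A ∈ Subgroup.closure (Set.range γ)) (hA1 : A ≠ 1) :
    ∃ a, moebius A z ∈ trap γ B z a := by
  obtain ⟨L, hL, rfl⟩ := exists_isReduced_of_mem_closure γ hA
  cases L with
  | nil => exact absurd (by rw [← FreeGroup.one_eq_mk, map_one]) hA1
  | cons a L => exact ⟨a, h.word_mem_trap hz L a hL⟩

/-- Any other element is a nonempty reduced word and pushes `z` into the disc of its first letter.
Discreteness of the group will follow from this. -/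
theorem eq_one_of_forall_notMem (h : IsPingPong γ B) {z : OnePoint ℂ} (hz : ∀ a, z ∉ B a)
    {A : SL(2, ℂ)} (hA : A ∈ Subgroup.closure (Set.range γ))
    (hAz : ∀ a, moebius A z ∉ B a) : A = 1 := by
  by_contra hA1
  obtain ⟨a, ha⟩ := h.exists_mem_trap hz hA hA1
  exact hAz a (h.pingSet_subset a (h.trap_subset_pingSet hz a ha))

theorem eventually_ne {ι : Type*} (U : Ultrafilter ι)
    {A : ι → Subgroup.closure (Set.range γ)} (hA : Tendsto A U cofinite)
    (C : Subgroup.closure (Set.range γ)) :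
    ∀ᶠ i in (U : Filter ι), A i ≠ C :=
  hA.eventually (Set.finite_singleton C).compl_mem_cofinite

theorem exists_mem_trap_of_tendsto (h : IsPingPong γ B) {z : OnePoint ℂ} (hz : ∀ a, z ∉ B a)
    {ι : Type*} (U : Ultrafilter ι)
    {A : ι → Subgroup.closure (Set.range γ)} (hA : Tendsto A U cofinite)
    {ξ : OnePoint ℂ}
    (hξ : Tendsto (fun i => moebius (A i) z) U (𝓝 ξ)) : ∃ a, ξ ∈ trap γ B z a := by
  have hcl : IsClosed (⋃ a, trap γ B z a) := isClosed_iUnion_of_finite fun a => h.isClosed_trap a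
  refine Set.mem_iUnion.mp (hcl.mem_of_tendsto hξ ?_)
  filter_upwards [eventually_ne U hA 1] with i hi
  exact Set.mem_iUnion.mpr
    (h.exists_mem_trap hz (A i).2 fun h1 => hi (Subtype.ext h1))

/-- The group is discrete: its elements tend to infinity. -/
theorem eventually_exists_lt_norm (h : IsPingPong γ B) {z : OnePoint ℂ} (hz : ∀ a, z ∉ B a)
    {ι : Type*} (U : Ultrafilter ι)
    {A : ι → Subgroup.closure (Set.range γ)} (hA : Tendsto A U cofinite)
    (R : ℝ) :
    ∀ᶠ i in (U : Filter ι), ∃ j k, R < ‖(A i : SL(2, ℂ)) j k‖ := by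
  by_contra hcon
  rw [← Ultrafilter.eventually_not] at hcon
  have hK : IsCompact {M : Matrix (Fin 2) (Fin 2) ℂ | ∀ j k, ‖M j k‖ ≤ R} := by
    have h1 : {M : Matrix (Fin 2) (Fin 2) ℂ | ∀ j k, ‖M j k‖ ≤ R} =
        Set.univ.pi fun _ : Fin 2 => Set.univ.pi fun _ : Fin 2 => Metric.closedBall (0 : ℂ) R := by
      ext M
      exact ⟨fun h j _ k _ => mem_closedBall_zero_iff.mpr (h j k),
        fun h j k => mem_closedBall_zero_iff.mp (h j trivial k trivial)⟩
    rw [h1]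
    exact isCompact_univ_pi fun _ => isCompact_univ_pi fun _ => isCompact_closedBall _ _
  have hK' := (Matrix.SpecialLinearGroup.isClosedEmbedding_val
    (n := Fin 2) (R := ℂ)).isCompact_preimage hK
  obtain ⟨C, hC'⟩ : ∃ C : SL(2, ℂ), Tendsto (fun i => (A i : SL(2, ℂ))) U (𝓝 C) := by
    obtain ⟨C, -, hC⟩ := hK'.ultrafilter_le_nhds' (U.map fun i => (A i : SL(2, ℂ))) (by
      change ∀ᶠ i in (U : Filter ι), ∀ j k, ‖(A i : SL(2, ℂ)) j k‖ ≤ R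
      filter_upwards [hcon] with i hi
      push Not at hi
      exact hi)
    exact ⟨C, hC⟩
  -- If the matrices stayed bounded they would converge along `U`, so the quotients of two of them
  -- would tend to `1`. A quotient near `1` keeps `z` outside the discs and must be `1`, making the
  -- family constant along `U`, against `hA`.
  have hprod : Tendsto (fun p : ι × ι => (A p.1 : SL(2, ℂ))⁻¹ * A p.2)
      ((U : Filter ι) ×ˢ (U : Filter ι)) (𝓝 1) := by
    have := (hC'.comp tendsto_fst).inv.mul (hC'.comp (tendsto_snd (f := (U : Filter ι))))
    rwa [inv_mul_cancel] at this
  have hcont : ContinuousAt (fun C : SL(2, ℂ) => moebius C z) 1 :=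
    (continuousAt_iff_ultrafilter).mpr fun G hG =>
      tendsto_moebius (A := id) hG tendsto_const_nhds
  have hev : ∀ᶠ p : ι × ι in (U : Filter ι) ×ˢ (U : Filter ι), A p.2 = A p.1 := by
    have h1 := hcont.tendsto.comp hprod
    rw [moebius_one] at h1
    filter_upwards [h1.eventually (h.isOpen_setOf_forall_notMem.mem_nhds hz)] with p hp
    have h2 := h.eq_one_of_forall_notMem hz (mul_mem (inv_mem (A p.1).2) (A p.2).2) hp
    exact (Subtype.ext (inv_mul_eq_one.mp h2)).symm
  obtain ⟨i, hi⟩ := hev.curry.exists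
  obtain ⟨j, hj1, hj2⟩ := (hi.and (eventually_ne U hA (A i))).exists
  exact hj2 hj1

/-- The convergence property of the group, with attracting and repelling points in the discs. -/
theorem exists_attracting_repelling (h : IsPingPong γ B)
    {ι : Type*} (U : Ultrafilter ι)
    {A : ι → Subgroup.closure (Set.range γ)} (hA : Tendsto A U cofinite)
    (hg : 2 ≤ g) : ∃ a r : OnePoint ℂ,
    (∃ b, a ∈ B b) ∧ (∃ b, r ∈ B b) ∧
    (∀ (z : ι → OnePoint ℂ) (η : OnePoint ℂ), Tendsto z U (𝓝 η) → η ≠ r →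
      Tendsto (fun i => moebius (A i) (z i)) U (𝓝 a)) ∧
    (∀ (z : ι → OnePoint ℂ) (η : OnePoint ℂ), Tendsto z U (𝓝 η) → η ≠ a →
      Tendsto (fun i => moebius (A i : SL(2, ℂ))⁻¹ (z i)) U (𝓝 r)) := by
  obtain ⟨z, hz⟩ := h.exists_forall_notMem hg
  obtain ⟨a, r, har, hra⟩ := CantorTriple.exists_attracting_repelling U
    (fun i => (A i : SL(2, ℂ))) (h.eventually_exists_lt_norm hz U hA)
  have hinv : Tendsto (fun i => (A i)⁻¹) U cofinite := inv_injective.tendsto_cofinite.comp hA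
  have hmem : ∀ {x y}, (∀ a, x ∉ B a) → (∃ b, y ∈ trap γ B x b) → ∃ b, y ∈ B b :=
    fun hx ⟨b, hb⟩ => ⟨b, h.pingSet_subset b (h.trap_subset_pingSet hx b hb)⟩
  have hr : ∃ b, r ∈ B b := by
    -- It is not yet known that `a` lies in a disc, so a base point avoiding `a` is chosen. Once `r`
    -- is in a disc, `z ≠ r` is automatic.
    obtain ⟨w, hwa, hw⟩ := h.exists_ne_forall_notMem hg a
    exact hmem hw (h.exists_mem_trap_of_tendsto hw U hinv (hra _ w tendsto_const_nhds hwa))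
  refine ⟨a, r, ?_, hr, har, hra⟩
  refine hmem hz (h.exists_mem_trap_of_tendsto hz U hA (har _ z tendsto_const_nhds ?_))
  rintro rfl
  exact hr.elim hz

/-- The accumulation points of the orbit of `z` form an invariant set. -/
theorem mapClusterPt_moebius {z : OnePoint ℂ}
    {C : SL(2, ℂ)} (hC : C ∈ Subgroup.closure (Set.range γ))
    {ξ : OnePoint ℂ} (hξ : MapClusterPt ξ cofinite
      fun A : Subgroup.closure (Set.range γ) => moebius A z) :
    MapClusterPt (moebius C ξ) cofinite
      fun A : Subgroup.closure (Set.range γ) => moebius A z := by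
  obtain ⟨C, rfl⟩ : ∃ C' : Subgroup.closure (Set.range γ), (C' : SL(2, ℂ)) = C := ⟨⟨C, hC⟩, rfl⟩
  let f : Subgroup.closure (Set.range γ) → OnePoint ℂ := fun A => moebius A z
  have h1 : MapClusterPt (moebius C ξ) cofinite (moebius C ∘ f) :=
    hξ.continuousAt_comp (continuous_moebius C).continuousAt
  have h2 : f ∘ (fun A => C * A) = moebius C ∘ f := funext fun A => moebius_mul C A z
  have h3 : Tendsto (fun A => C * A) cofinite cofinite :=
    (mul_right_injective C).tendsto_cofinite
  rw [← h2] at h1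
  exact MapClusterPt.of_comp h3 h1

/-- The limit set is the set of accumulation points of the orbit of a point outside the discs. -/
theorem mem_limitSet_iff (h : IsPingPong γ B) {z : OnePoint ℂ} (hz : ∀ a, z ∉ B a) (hg : 2 ≤ g)
    {ξ : OnePoint ℂ} : ξ ∈ limitSet (Subgroup.closure (Set.range γ)) ↔
    MapClusterPt ξ cofinite fun A : Subgroup.closure (Set.range γ) => moebius A z := by
  refine ⟨?_, fun hξ => ⟨z, hξ⟩⟩
  rintro ⟨y, hy⟩
  obtain ⟨U, hU, hUy⟩ := mapClusterPt_iff_ultrafilter.mp hy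
  obtain ⟨a, r, ⟨b, ha⟩, ⟨c, hr⟩, har, hra⟩ := h.exists_attracting_repelling U (A := id) hU hg
  by_cases hyr : y = r
  -- At the repelling point the dynamics gives no control of `A y`. But `r` is itself an
  -- accumulation point of the orbit of `z`, through the inverses, and these accumulation points
  -- form a closed invariant set.
  · have hrL : MapClusterPt r cofinite
        fun A : Subgroup.closure (Set.range γ) => moebius A z := by
      refine MapClusterPt.of_comp (φ := fun A => A⁻¹) (p := (U : Filter _))
        (inv_injective.tendsto_cofinite.mono_left hU) ?_
      refine (hra (fun _ => z) z tendsto_const_nhds ?_).mapClusterPt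
      rintro rfl
      exact hz b ha
    have hcl : IsClosed {ξ | MapClusterPt ξ cofinite
        fun A : Subgroup.closure (Set.range γ) => moebius A z} := isClosed_setOfPred_clusterPt
    exact hcl.mem_of_tendsto hUy (Filter.Eventually.of_forall fun A =>
      mapClusterPt_moebius A.2 (hyr ▸ hrL))
  · have h1 := har (fun _ => y) y tendsto_const_nhds hyr
    have h2 := har (fun _ => z) z tendsto_const_nhds (by rintro rfl; exact hz c hr)
    rw [tendsto_nhds_unique hUy h1]
    exact mapClusterPt_iff_ultrafilter.mpr ⟨U, hU, h2⟩

theorem moebius_mem_limitSet (h : IsPingPong γ B) {z : OnePoint ℂ} (hz : ∀ a, z ∉ B a) (hg : 2 ≤ g)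
    {C : SL(2, ℂ)} (hC : C ∈ Subgroup.closure (Set.range γ))
    {ξ : OnePoint ℂ} (hξ : ξ ∈ limitSet (Subgroup.closure (Set.range γ))) :
    moebius C ξ ∈ limitSet (Subgroup.closure (Set.range γ)) := by
  rw [h.mem_limitSet_iff hz hg] at hξ ⊢
  exact mapClusterPt_moebius hC hξ

theorem exists_mem_pingSet (h : IsPingPong γ B) {z : OnePoint ℂ} (hz : ∀ a, z ∉ B a) (hg : 2 ≤ g)
    {ξ : OnePoint ℂ}
    (hξ : ξ ∈ limitSet (Subgroup.closure (Set.range γ))) : ∃ a, ξ ∈ pingSet γ B a := by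
  rw [h.mem_limitSet_iff hz hg] at hξ
  obtain ⟨U, hU, hUz⟩ := mapClusterPt_iff_ultrafilter.mp hξ
  obtain ⟨a, ha⟩ := h.exists_mem_trap_of_tendsto hz U (A := id) hU hUz
  exact ⟨a, h.trap_subset_pingSet hz a ha⟩

/-- The itinerary of a limit point. -/
theorem exists_itinerary (h : IsPingPong γ B) {z : OnePoint ℂ} (hz : ∀ a, z ∉ B a) (hg : 2 ≤ g)
    {ξ : OnePoint ℂ}
    (hξ : ξ ∈ limitSet (Subgroup.closure (Set.range γ))) :
    ∃ ω : InfWord (Fin g), ∀ n, moebius (prefixProd γ ω n)⁻¹ ξ ∈ pingSet γ B (ω.1 n) := by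
  let L := limitSet (Subgroup.closure (Set.range γ))
  choose f hf using fun x : L => h.exists_mem_pingSet hz hg x.2
  let T : L → L := fun x => ⟨moebius (letter γ (f x))⁻¹ x,
    h.moebius_mem_limitSet hz hg (inv_mem (letter_mem_closure γ _)) x.2⟩
  let x : ℕ → L := fun n => T^[n] ⟨ξ, hξ⟩
  have hx : ∀ n, (x (n + 1) : OnePoint ℂ) = moebius (letter γ (f (x n)))⁻¹ (x n) := fun n => by
    simp only [x, Function.iterate_succ_apply']
    rfl
  -- Stripping the letter `f (x n)` lands outside the disc of its inverse, so that inverse cannot be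
  -- the next letter.
  have hred : ∀ n, f (x (n + 1)) ≠ invLetter (f (x n)) := by
    intro n hn
    obtain ⟨y, hy, hyx⟩ := hf (x n)
    have h1 : (x (n + 1) : OnePoint ℂ) = y := by rw [hx, ← hyx, moebius_inv_moebius]
    refine hy ?_
    rw [← h1, ← hn]
    exact h.pingSet_subset _ (hf _)
  let ω : InfWord (Fin g) := ⟨fun n => f (x n), hred⟩
  refine ⟨ω, fun n => ?_⟩
  have h1 : ∀ n, moebius (prefixProd γ ω n)⁻¹ ξ = x n := by
    intro n
    induction n with
    | zero => simp [prefixProd, moebius_one, x]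
    | succ n ih => rw [prefixProd, mul_inv_rev, moebius_mul, ih, hx]
  rw [h1]
  exact hf (x n)

/-- The product is the inverse of the subword at positions `m, …, m + k`, a reduced word starting
with the inverse of the last letter. It serves twice: to separate distinct prefixes, and, with `m =
0`, to locate the repelling point of the prefixes. -/
theorem prefixProd_inv_mem (h : IsPingPong γ B) {z : OnePoint ℂ} (hz : ∀ a, z ∉ B a)
    (ω : InfWord (Fin g)) (m k : ℕ) :
    moebius ((prefixProd γ ω (m + k + 1))⁻¹ * prefixProd γ ω m) z ∈
      B (invLetter (ω.1 (m + k))) := by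
  refine h.pingSet_subset _ ?_
  rw [prefixProd, mul_inv_rev, ← letter_invLetter, mul_assoc, moebius_mul]
  refine Set.mem_image_of_mem _ ?_
  rw [invLetter_invLetter]
  cases k with
  | zero =>
    rw [add_zero, inv_mul_cancel, moebius_one]
    exact hz _
  | succ k =>
    exact h.notMem_of_mem (fun h1 => ω.2 (m + k) h1.symm) (h.prefixProd_inv_mem hz ω m k)

theorem injective_prefixProd (h : IsPingPong γ B) {z : OnePoint ℂ} (hz : ∀ a, z ∉ B a)
    (ω : InfWord (Fin g)) : Function.Injective (prefixProd γ ω) := by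
  have key : ∀ m n, m < n → prefixProd γ ω m ≠ prefixProd γ ω n := by
    intro m n hmn heq
    obtain ⟨k, rfl⟩ := Nat.exists_eq_add_of_lt hmn
    have h1 := h.prefixProd_inv_mem hz ω m k
    rw [← heq, inv_mul_cancel, moebius_one] at h1
    exact hz _ h1
  intro m n hmn
  rcases lt_trichotomy m n with hlt | heq | hlt
  · exact absurd hmn (key m n hlt)
  · exact heq
  · exact absurd hmn.symm (key n m hlt)

/-- The itinerary of a limit point denotes it. -/
theorem exists_schottkyCodes (h : IsPingPong γ B) {z : OnePoint ℂ} (hz : ∀ a, z ∉ B a) (hg : 2 ≤ g)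
    (ξ : limitSet (Subgroup.closure (Set.range γ))) :
    ∃ ω : InfWord (Fin g), schottkyCodes γ ω ξ := by
  obtain ⟨ω, hω⟩ := h.exists_itinerary hz hg ξ.2
  refine ⟨ω, fun y hy => (tendsto_iff_ultrafilter _ _ _).mpr fun V hV => ?_⟩
  let A : ℕ → Subgroup.closure (Set.range γ) := fun n =>
    ⟨prefixProd γ ω n, prefixProd_mem_closure γ ω n⟩
  have hAinj : Function.Injective A := fun m n hmn =>
    h.injective_prefixProd hz ω (congrArg Subtype.val hmn)
  have hA : Tendsto A V cofinite := by
    refine hAinj.tendsto_cofinite.comp ?_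
    rw [Nat.cofinite_eq_atTop]
    exact hV
  obtain ⟨a, r, ⟨b, ha⟩, ⟨c, hr⟩, har, hra⟩ := h.exists_attracting_repelling V hA hg
  have hza : z ≠ a := by rintro rfl; exact hz b ha
  have hrz := hra (fun _ => z) z tendsto_const_nhds hza
  have hyr : y ≠ r := by
    rintro rfl
    refine hy ((h.mem_limitSet_iff hz hg).mpr ?_)
    exact MapClusterPt.of_comp (φ := fun n => (A n)⁻¹) (p := (V : Filter ℕ))
      (inv_injective.tendsto_cofinite.comp hA) hrz.mapClusterPt
  have hay := har (fun _ => y) y tendsto_const_nhds hyr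
  suffices hξ : (ξ : OnePoint ℂ) = a by rw [hξ]; exact hay
  -- The alphabet is finite, so the pair (previous letter, next letter) is constant along `V`. Then
  -- `r` lies in the disc of the inverse of the previous letter, and the limit `η` of the stripped
  -- points lies in the disc of the next one. These discs differ since `ω` is reduced; so `η ≠ r`,
  -- and reapplying the prefixes shows that the constant sequence `ξ` tends to `a`.
  obtain ⟨d, hd⟩ := (V.map fun n => (ω.1 (n - 1), ω.1 n)).eq_pure_of_finite
  have hdV : ∀ᶠ n in (V : Filter ℕ), (ω.1 (n - 1), ω.1 n) = d := by
    have : ∀ᶠ x in ((V.map fun n => (ω.1 (n - 1), ω.1 n) : Ultrafilter _) : Filter _), x = d := by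
      rw [hd]
      exact (rfl : d = d)
    exact this
  have hpos : ∀ᶠ n in (V : Filter ℕ), 1 ≤ n := hV (eventually_ge_atTop 1)
  have hdd : d.2 ≠ invLetter d.1 := by
    obtain ⟨n, rfl, hn⟩ := (hdV.and hpos).exists
    obtain ⟨m, rfl⟩ := Nat.exists_eq_add_of_le' hn
    exact ω.2 m
  have hrd : r ∈ B (invLetter d.1) := by
    refine (h.closed _).mem_of_tendsto hrz ?_
    filter_upwards [hdV, hpos] with n hn hn1
    obtain ⟨m, rfl⟩ := Nat.exists_eq_add_of_le' hn1
    have h1 := h.prefixProd_inv_mem hz ω 0 m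
    simp only [prefixProd, mul_one, zero_add] at h1
    rw [← hn]
    exact h1
  obtain ⟨η, -, hη⟩ := isCompact_univ.ultrafilter_le_nhds'
    (V.map fun n => moebius (prefixProd γ ω n)⁻¹ ξ) Filter.univ_mem
  have hηd : η ∈ B d.2 := by
    refine (h.closed _).mem_of_tendsto (f := fun n => moebius (prefixProd γ ω n)⁻¹ ξ)
      (b := (V : Filter ℕ)) hη ?_
    filter_upwards [hdV] with n hn
    rw [← hn]
    exact h.pingSet_subset _ (hω n)
  have hηr : η ≠ r := by
    rintro rfl
    exact h.notMem_of_mem hdd hηd hrd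
  have hlim := har (fun n => moebius (prefixProd γ ω n)⁻¹ ξ) η hη hηr
  refine tendsto_nhds_unique (tendsto_const_nhds (f := (V : Filter ℕ))) (hlim.congr fun n => ?_)
  exact moebius_moebius_inv _ _

end IsPingPong

theorem IsSchottky.cylinder_nil (hg : 2 ≤ g) (hγ : IsSchottky γ) :
    cylinder (schottkyCodes γ) [] = Set.univ := by
  obtain ⟨B, h⟩ := hγ.exists_isPingPong
  obtain ⟨z, hz⟩ := h.exists_forall_notMem hg
  refine Set.eq_univ_of_forall fun ξ => ?_
  obtain ⟨ω, hω⟩ := h.exists_schottkyCodes hz hg ξ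
  exact ⟨ω, fun i => i.elim0, hω⟩

end PingPong

/-! ## Coarse paths in free groups -/

section FreeGroups

variable {ι : Type*}

theorem lift_prefixProd {G : Type*} [Group G] (s : ι → G) (ω : InfWord ι) (n : ℕ) :
    FreeGroup.lift s (prefixProd FreeGroup.of ω n) = prefixProd s ω n := by
  induction n with
  | zero => simp [prefixProd]
  | succ n ih =>
    rw [prefixProd, prefixProd, map_mul, ih]
    congr 1
    rcases ω.1 n with ⟨i, _ | _⟩ <;> simp [letter]

theorem letter_of (a : ι × Bool) : letter FreeGroup.of a = FreeGroup.mk [a] := by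
  rcases a with ⟨i, _ | _⟩ <;> simp [letter, FreeGroup.of, FreeGroup.inv_mk, FreeGroup.invRev]

variable [DecidableEq ι]

theorem toWord_mul_letter (x : FreeGroup ι) (a : ι × Bool) :
    (x * FreeGroup.mk [a]).toWord = x.toWord ++ [a] ∨
      x.toWord = (x * FreeGroup.mk [a]).toWord ++ [invLetter a] := by
  have hx : x * FreeGroup.mk [a] = FreeGroup.mk (x.toWord ++ [a]) := by
    rw [← FreeGroup.mul_mk, FreeGroup.mk_toWord]
  have hred : FreeGroup.IsReduced x.toWord := FreeGroup.isReduced_toWord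
  rcases List.eq_nil_or_concat x.toWord with h0 | ⟨L, b, hL⟩
  · left
    rw [hx, h0, FreeGroup.toWord_mk]
    exact FreeGroup.IsReduced.singleton.reduce_eq
  · rw [List.concat_eq_append] at hL
    by_cases hb : b = invLetter a
    · right
      have h1 : x * FreeGroup.mk [a] = FreeGroup.mk L := by
        rw [hx, hL, ← FreeGroup.mul_mk, ← FreeGroup.mul_mk, hb, ← letter_of, ← letter_of,
          letter_invLetter, mul_assoc, inv_mul_cancel, mul_one]
      have h2 : FreeGroup.IsReduced L := hred.infix ⟨[], [b], by simp [hL]⟩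
      rw [h1, FreeGroup.toWord_mk, h2.reduce_eq, hL, hb]
    · left
      rw [hx, FreeGroup.toWord_mk]
      refine FreeGroup.IsReduced.reduce_eq ?_
      rw [hL] at hred ⊢
      refine List.isChain_append.mpr ⟨hred, List.isChain_singleton a, ?_⟩
      intro y hy z hz hyz
      simp only [List.getLast?_append, List.getLast?_singleton, Option.some_or,
        Option.mem_def, Option.some.injEq, List.head?_cons] at hy hz
      subst hy hz
      by_contra hne
      refine hb (Prod.ext hyz ?_)
      simp only [invLetter]
      cases h1 : b.2 <;> cases h2 : a.2 <;> simp_all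

/-- Each factor appends or cancels one letter at the end, so `M.length` factors cannot reach the
first `n` letters. -/
theorem take_toWord_mul_mk (M : List (ι × Bool)) (x : FreeGroup ι) (n : ℕ)
    (h : n + M.length ≤ x.norm) :
    (x * FreeGroup.mk M).toWord.take n = x.toWord.take n := by
  induction M generalizing x with
  | nil => rw [← FreeGroup.one_eq_mk, mul_one]
  | cons a M ih =>
    have h1 : x * FreeGroup.mk (a :: M) = (x * FreeGroup.mk [a]) * FreeGroup.mk M := by
      rw [mul_assoc, FreeGroup.mul_mk]; rfl
    simp only [FreeGroup.norm, List.length_cons] at h ih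
    rcases toWord_mul_letter x a with h2 | h2
    · rw [h1, ih, h2, List.take_append_of_le_length (by omega)]
      rw [h2, List.length_append]
      omega
    · have h3 := congrArg List.length h2
      rw [List.length_append, List.length_singleton] at h3
      rw [h1, ih _ (by omega), h2, List.take_append_of_le_length (by omega)]

theorem take_toWord_mul (x t : FreeGroup ι) (n : ℕ) (h : n + t.norm ≤ x.norm) :
    (x * t).toWord.take n = x.toWord.take n := by
  have := take_toWord_mul_mk t.toWord x n h
  rwa [FreeGroup.mk_toWord] at this

/-- A coarse path in the free group that tends to infinity stays close to an infinite reduced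
word. -/
theorem exists_infWord_of_coarse_path (h : ℕ → FreeGroup ι) (L : ℕ)
    (hL : ∀ k, ((h k)⁻¹ * h (k + 1)).norm ≤ L)
    (htop : Tendsto (fun k => (h k).norm) atTop atTop) :
    ∃ ω : InfWord ι, ∀ k₀, ∀ᶠ n in atTop, ∃ m ≥ k₀,
      ((h m)⁻¹ * prefixProd FreeGroup.of ω n).norm ≤ 2 * L := by
  -- The margin `L` is the step length: once the norm stays at least `n + L`, no step can alter the
  -- first `n` letters.
  have hex : ∀ n, ∃ m, ∀ j ≥ m, n + L ≤ (h j).norm := fun n =>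
    eventually_atTop.mp (htop.eventually_ge_atTop (n + L))
  classical
  let K : ℕ → ℕ := fun n => Nat.find (hex n)
  have hK : ∀ n, ∀ j ≥ K n, n + L ≤ (h j).norm := fun n => Nat.find_spec (hex n)
  have hstable : ∀ n, ∀ j ≥ K n, (h j).toWord.take n = (h (K n)).toWord.take n := by
    intro n j hj
    induction j, hj using Nat.le_induction with
    | base => rfl
    | succ j hj ih =>
      rw [← ih, ← take_toWord_mul (h j) ((h j)⁻¹ * h (j + 1)) n, mul_inv_cancel_left]
      exact (Nat.add_le_add_left (hL j) n).trans (hK n j hj)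
  let p : ℕ → List (ι × Bool) := fun n => (h (K n)).toWord.take n
  have hp : ∀ n, ∃ a, p (n + 1) = p n ++ [a] := by
    intro n
    let j := max (K n) (K (n + 1))
    have h1 : p n = (h j).toWord.take n := (hstable n j (le_max_left _ _)).symm
    have h2 : p (n + 1) = (h j).toWord.take (n + 1) := (hstable (n + 1) j (le_max_right _ _)).symm
    have h3 : n < (h j).toWord.length := by
      have := hK (n + 1) j (le_max_right _ _)
      simp only [FreeGroup.norm] at this
      omega
    exact ⟨(h j).toWord[n], by rw [h1, h2, List.take_append_getElem h3]⟩
  choose a ha using hp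
  have hred : ∀ n, FreeGroup.IsReduced (p n) := fun n =>
    FreeGroup.isReduced_toWord.infix (List.take_prefix n (h (K n)).toWord).isInfix
  let ω : InfWord ι := ⟨a, fun n => by
    have h1 := hred (n + 2)
    rw [ha, ha, List.append_assoc] at h1
    exact ne_invLetter_of_isReduced_cons_cons (L := []) (h1.infix ⟨p n, [], by simp⟩)⟩
  have hω : ∀ n, prefixProd FreeGroup.of ω n = FreeGroup.mk (p n) := by
    intro n
    induction n with
    | zero => simp [prefixProd, p, FreeGroup.one_eq_mk]
    | succ n ih => rw [prefixProd, ih, ha, letter_of, FreeGroup.mul_mk]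
  refine ⟨ω, fun k₀ => ?_⟩
  filter_upwards [eventually_gt_atTop (h k₀).norm] with n hn
  have hk : k₀ < K n := by
    by_contra hle
    have := hK n k₀ (not_lt.mp hle)
    omega
  refine ⟨K n, hk.le, ?_⟩
  obtain ⟨m, hm⟩ := Nat.exists_eq_add_of_lt hk
  -- By minimality of `K n`, the norm just before time `K n` is below `n + L`. One step adds at most
  -- `L`, so at most `2 * L` letters remain after the first `n`.
  have hprev : (h (k₀ + m)).norm < n + L := by
    by_contra hle
    refine Nat.find_min (hex n) (m := k₀ + m) (show k₀ + m < K n by omega) fun j hj => ?_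
    rcases hj.eq_or_lt with rfl | hlt
    · exact not_lt.mp hle
    · exact hK n j (by omega)
  have hcur : (h (K n)).norm ≤ (h (k₀ + m)).norm + L := by
    rw [hm, ← mul_inv_cancel_left (h (k₀ + m)) (h (k₀ + m + 1))]
    exact (FreeGroup.norm_mul_le _ _).trans (Nat.add_le_add_left (hL _) _)
  have hsplit : h (K n) = FreeGroup.mk (p n) * FreeGroup.mk ((h (K n)).toWord.drop n) := by
    rw [FreeGroup.mul_mk, List.take_append_drop, FreeGroup.mk_toWord]
  have hinv : (h (K n))⁻¹ * prefixProd FreeGroup.of ω n =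
      (FreeGroup.mk ((h (K n)).toWord.drop n))⁻¹ := by
    rw [hω]
    nth_rewrite 1 [hsplit]
    group
  rw [hinv, FreeGroup.norm_inv_eq]
  refine FreeGroup.norm_mk_le.trans ?_
  rw [List.length_drop]
  simp only [FreeGroup.norm] at hcur hprev ⊢
  omega

theorem finite_norm_le [Finite ι] (N : ℕ) : {x : FreeGroup ι | x.norm ≤ N}.Finite :=
  (List.finite_length_le (ι × Bool) N).preimage FreeGroup.toWord_injective.injOn

end FreeGroups

/-! ## Geodesics in trees -/

section Trees

variable {W : Type*} {T : SimpleGraph W}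

theorem dist_iso_le (hT : T.Connected) (f : T ≃g T) (x y : W) :
    T.dist (f x) (f y) ≤ T.dist x y := by
  obtain ⟨w, hw⟩ := hT.exists_walk_length_eq_dist x y
  rw [← hw, ← SimpleGraph.Walk.length_map f.toHom w]
  exact SimpleGraph.dist_le _

theorem dist_iso (hT : T.Connected) (f : T ≃g T) (x y : W) : T.dist (f x) (f y) = T.dist x y := by
  refine le_antisymm (dist_iso_le hT f x y) ?_
  simpa using dist_iso_le hT f.symm (f x) (f y)

/-- Both neighbours are penultimate on a geodesic from `u` to `y`, and paths in a tree are unique.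
-/
theorem eq_of_adj_of_dist_add_one (hT : T.IsTree) {u y a b : W} (ha : T.Adj a y) (hb : T.Adj b y)
    (hda : T.dist u a + 1 = T.dist u y) (hdb : T.dist u b + 1 = T.dist u y) : a = b := by
  obtain ⟨v, hv⟩ := hT.connected.exists_walk_length_eq_dist u a
  obtain ⟨w, hw⟩ := hT.connected.exists_walk_length_eq_dist u b
  have h1 : (v.concat ha).IsPath := SimpleGraph.Walk.isPath_of_length_eq_dist _ (by
    rw [SimpleGraph.Walk.length_concat, hv, hda])
  have h2 : (w.concat hb).IsPath := SimpleGraph.Walk.isPath_of_length_eq_dist _ (by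
    rw [SimpleGraph.Walk.length_concat, hw, hdb])
  have h3 := congrArg SimpleGraph.Walk.penultimate ((hT.existsUnique_path u y).unique h1 h2)
  simpa using h3

theorem exists_adj_dist_add_one (hT : T.Connected) {u y : W} (h : u ≠ y) :
    ∃ a, T.Adj a y ∧ T.dist u a + 1 = T.dist u y := by
  obtain ⟨w, hw⟩ := hT.exists_walk_length_eq_dist y u
  cases w with
  | nil => exact absurd rfl h
  | @cons _ a _ hya w =>
    refine ⟨a, hya.symm, le_antisymm ?_ ?_⟩
    · rw [T.dist_comm (u := u) (v := y), ← hw, SimpleGraph.Walk.length_cons, T.dist_comm]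
      exact Nat.add_le_add_right (SimpleGraph.dist_le w) 1
    · refine hT.dist_triangle.trans (Nat.add_le_add_left ?_ _)
      exact (SimpleGraph.dist_eq_one_iff_adj.mpr hya.symm).le

/-- If `v` lies on the geodesic from `u` to `y ≠ v`, it also lies on the geodesic from `u` to each
neighbour of `y`. -/
theorem dist_add_dist_of_adj (hT : T.IsTree) {u v y y' : W} (hadj : T.Adj y y') (hvy : v ≠ y)
    (h : T.dist u v + T.dist v y = T.dist u y) : T.dist u v + T.dist v y' = T.dist u y' := by
  have htri : T.dist u y' ≤ T.dist u v + T.dist v y' := hT.connected.dist_triangle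
  rcases hT.dist_eq_dist_add_one_of_adj u hadj with h1 | h1 <;>
    rcases hT.dist_eq_dist_add_one_of_adj v hadj with h2 | h2
  · omega
  -- Here `y'` is nearer to `u` but farther from `v`. The neighbour of `y` towards `v` is also
  -- nearer to `u`, so it would have to be `y'`.
  · obtain ⟨a, ha, hva⟩ := exists_adj_dist_add_one hT.connected hvy
    have h3 : T.dist u a + 1 = T.dist u y := by
      have h4 : T.dist u a ≤ T.dist u v + T.dist v a := hT.connected.dist_triangle
      have h5 := hT.dist_eq_dist_add_one_of_adj u ha
      omega
    obtain rfl := eq_of_adj_of_dist_add_one hT ha hadj.symm h3 h1.symm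
    omega
  · omega
  · omega

theorem dist_add_dist_of_walk (hT : T.IsTree) {u v a b : W} (w : T.Walk a b)
    (hlen : w.length < T.dist v a) (h : T.dist u v + T.dist v a = T.dist u a) :
    T.dist u v + T.dist v b = T.dist u b := by
  induction w with
  | nil => exact h
  | @cons a c b hadj w ih =>
    rw [SimpleGraph.Walk.length_cons] at hlen
    have h1 : v ≠ a := by
      rintro rfl
      simp at hlen
    refine ih ?_ (dist_add_dist_of_adj hT hadj h1 h)
    have := hT.dist_eq_dist_add_one_of_adj v hadj
    omega

variable {x₀ : W}

/-- A first step back towards `x₀` would have to return to the preceding vertex, the only neighbour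
nearer to `x₀`. -/
theorem dist_ray (hT : T.IsTree) (ξ : TreeBoundary T x₀) (n : ℕ) : T.dist x₀ (ξ.1 n) = n := by
  obtain ⟨r, hr0, hadj, hback⟩ := ξ
  induction n using Nat.strong_induction_on with
  | _ n ih =>
    match n with
    | 0 => simp [hr0]
    | 1 =>
      have := hadj 0
      rw [hr0] at this
      exact SimpleGraph.dist_eq_one_iff_adj.mpr this
    | n + 2 =>
      have h0 : T.dist x₀ (r n) = n := ih n (by omega)
      have h1 : T.dist x₀ (r (n + 1)) = n + 1 := ih (n + 1) (by omega)
      change T.dist x₀ (r (n + 2)) = n + 2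
      rcases hT.dist_eq_dist_add_one_of_adj x₀ (hadj (n + 1)) with h2 | h2
      · refine absurd ?_ (hback n)
        exact eq_of_adj_of_dist_add_one hT (hadj (n + 1)).symm (hadj n) h2.symm
          (by rw [h0, h1])
      · have h3 : T.dist x₀ (r (n + 1 + 1)) = n + 2 := by omega
        exact h3

theorem dist_ray_ray (hT : T.IsTree) (ξ : TreeBoundary T x₀) (k m : ℕ) :
    T.dist (ξ.1 k) (ξ.1 (k + m)) = m := by
  refine le_antisymm ?_ ?_
  · induction m with
    | zero => simp
    | succ m ih =>
      refine hT.connected.dist_triangle.trans (Nat.add_le_add ih ?_)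
      exact (SimpleGraph.dist_eq_one_iff_adj.mpr (ξ.2.2.1 (k + m))).le
  · have h1 : T.dist x₀ (ξ.1 (k + m)) ≤ T.dist x₀ (ξ.1 k) + T.dist (ξ.1 k) (ξ.1 (k + m)) :=
      hT.connected.dist_triangle
    rw [dist_ray hT, dist_ray hT] at h1
    omega

/-- The geodesic to a point near a ray follows the ray for a long time. -/
theorem dist_add_dist_of_near_ray (hT : T.IsTree) (ξ : TreeBoundary T x₀) {k m C : ℕ} {y : W}
    (hm : k + C < m) (hy : T.dist (ξ.1 m) y ≤ C) :
    T.dist x₀ (ξ.1 k) + T.dist (ξ.1 k) y = T.dist x₀ y := by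
  obtain ⟨w, hw⟩ := hT.connected.exists_walk_length_eq_dist (ξ.1 m) y
  obtain ⟨j, rfl⟩ := Nat.exists_eq_add_of_lt hm
  have h1 : T.dist (ξ.1 k) (ξ.1 (k + C + j + 1)) = C + j + 1 := by
    have h2 := dist_ray_ray hT ξ k (C + j + 1)
    rwa [show k + (C + j + 1) = k + C + j + 1 by omega] at h2
  refine dist_add_dist_of_walk hT w ?_ ?_
  · rw [hw, h1]; omega
  · rw [h1, dist_ray hT, dist_ray hT]; omega

end Trees

/-! ## Free cocompact actions on trees -/

section FreeQuotient

variable {V E W : Type*} {T : SimpleGraph W} {Γ : Subgroup (T ≃g T)} {X : MultiGraph V E}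
  {p : W → V} {q : T.Dart → E}

/-- A deck transformation identifying two edges that leave `y` fixes `y`, hence is trivial; so these
edges inject into `E`. -/
theorem IsFreeQuotient.finite_neighborSet [Finite E] (h : IsFreeQuotient T Γ X p q) (y : W) :
    (T.neighborSet y).Finite := by
  refine Finite.of_injective (β := E) (fun z : T.neighborSet y => q ⟨(y, z.1), z.2⟩) ?_
  intro z z' hz
  obtain ⟨γ, hγ, h1, h2⟩ := (h.edge_eq_iff _ _).mp hz
  obtain rfl := h.free γ hγ y h1
  exact Subtype.ext h2

theorem IsFreeQuotient.finite_ball [Finite E] (h : IsFreeQuotient T Γ X p q) (hT : T.Connected)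
    (x : W) (N : ℕ) : {y | T.dist x y ≤ N}.Finite := by
  induction N with
  | zero =>
    refine (Set.finite_singleton x).subset fun y hy => ?_
    exact (hT.dist_eq_zero_iff.mp (Nat.le_zero.mp hy)).symm
  | succ N ih =>
    refine ((Set.finite_singleton x).union
      (ih.biUnion fun y _ => h.finite_neighborSet y)).subset fun y hy => ?_
    by_cases hxy : x = y
    · exact Or.inl hxy.symm
    · obtain ⟨a, ha, hda⟩ := exists_adj_dist_add_one hT hxy
      refine Or.inr (Set.mem_biUnion (x := a) ?_ ha)
      change T.dist x y ≤ N + 1 at hy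
      change T.dist x a ≤ N
      omega

theorem IsFreeQuotient.exists_dist_orbit_le [Finite V] (h : IsFreeQuotient T Γ X p q)
    (hT : T.Connected) (x : W) : ∃ R, ∀ v, ∃ γ ∈ Γ, T.dist (γ x) v ≤ R := by
  choose w hw using h.surjective_vertex
  obtain ⟨R, hR⟩ := (Set.finite_range fun c => T.dist x (w c)).bddAbove
  refine ⟨R, fun v => ?_⟩
  obtain ⟨γ, hγ, hv⟩ := (h.vertex_eq_iff _ _).mp (hw (p v))
  refine ⟨γ, hγ, ?_⟩
  rw [← hv, dist_iso hT]
  exact hR ⟨p v, rfl⟩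

/-- A Švarc–Milnor argument: the orbit is within bounded distance of the ray, and free action on a
locally finite tree turns distance bounds between orbit points into word length bounds; finiteness
of balls in the free group gives the converse. -/
theorem IsFreeQuotient.exists_treeCodes [Finite V] [Finite E] {g : ℕ} (hT : T.IsTree)
    {s : Fin g → (T ≃g T)} (hs : Function.Injective (FreeGroup.lift s))
    (h : IsFreeQuotient T (Subgroup.closure (Set.range s)) X p q) {x₀ : W}
    (ξ : TreeBoundary T x₀) : ∃ ω : InfWord (Fin g), treeCodes s ω ξ := by
  let ρ := FreeGroup.lift s
  have hρ : ∀ x, ρ x ∈ Subgroup.closure (Set.range s) := fun x => by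
    rw [← FreeGroup.range_lift_eq_closure]
    exact ⟨x, rfl⟩
  have hdist : ∀ x y, T.dist (ρ x x₀) (ρ y x₀) = T.dist x₀ (ρ (x⁻¹ * y) x₀) := by
    intro x y
    rw [← dist_iso hT.connected (ρ x) x₀, ← RelIso.mul_apply, ← map_mul, mul_inv_cancel_left]
  have hproper : ∀ N, {x | T.dist x₀ (ρ x x₀) ≤ N}.Finite := by
    intro N
    refine (h.finite_ball hT.connected x₀ N).preimage (f := fun x => ρ x x₀) ?_
    refine Function.Injective.injOn fun x y hxy => ?_
    have h1 : ρ (y⁻¹ * x) x₀ = x₀ := by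
      change ρ x x₀ = ρ y x₀ at hxy
      rw [map_mul, RelIso.mul_apply, hxy, ← RelIso.mul_apply, ← map_mul, inv_mul_cancel, map_one]
      rfl
    have h2 := hs ((h.free _ (hρ _) x₀ h1).trans (map_one ρ).symm)
    exact (inv_mul_eq_one.mp h2).symm
  obtain ⟨R, hR⟩ := h.exists_dist_orbit_le hT.connected x₀
  have hex : ∀ k, ∃ x : FreeGroup (Fin g), T.dist (ρ x x₀) (ξ.1 k) ≤ R := by
    intro k
    obtain ⟨γ, hγ, hd⟩ := hR (ξ.1 k)
    rw [← FreeGroup.range_lift_eq_closure] at hγ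
    obtain ⟨x, rfl⟩ := hγ
    exact ⟨x, hd⟩
  choose u hu using hex
  -- Consecutive shadowing points are at distance at most `R + 1 + R`, so their quotients lie in a
  -- finite set.
  obtain ⟨L, hL⟩ := ((hproper (2 * R + 1)).image FreeGroup.norm).bddAbove
  have hstep : ∀ k, ((u k)⁻¹ * u (k + 1)).norm ≤ L := by
    intro k
    refine hL (Set.mem_image_of_mem _ ?_)
    change T.dist x₀ (ρ ((u k)⁻¹ * u (k + 1)) x₀) ≤ 2 * R + 1
    rw [← hdist]
    have h1 : T.dist (ρ (u k) x₀) (ρ (u (k + 1)) x₀) ≤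
        T.dist (ρ (u k) x₀) (ξ.1 k) + T.dist (ξ.1 k) (ρ (u (k + 1)) x₀) :=
      hT.connected.dist_triangle
    have h2 : T.dist (ξ.1 k) (ρ (u (k + 1)) x₀) ≤
        T.dist (ξ.1 k) (ξ.1 (k + 1)) + T.dist (ξ.1 (k + 1)) (ρ (u (k + 1)) x₀) :=
      hT.connected.dist_triangle
    rw [dist_ray_ray hT, T.dist_comm (u := ξ.1 (k + 1))] at h2
    have h3 := hu k
    have h4 := hu (k + 1)
    omega
  have hbound : ∀ N, ∃ D, ∀ x : FreeGroup (Fin g), x.norm ≤ N → T.dist x₀ (ρ x x₀) ≤ D := by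
    intro N
    obtain ⟨D, hD⟩ := ((finite_norm_le (ι := Fin g) N).image
      fun x => T.dist x₀ (ρ x x₀)).bddAbove
    exact ⟨D, fun x hx => hD (Set.mem_image_of_mem _ hx)⟩
  have htop : Tendsto (fun k => (u k).norm) atTop atTop := by
    refine tendsto_atTop.mpr fun N => ?_
    obtain ⟨D, hD⟩ := hbound N
    filter_upwards [eventually_gt_atTop (D + R)] with k hk
    by_contra hlt
    have h1 := hD (u k) (not_le.mp hlt).le
    have h2 : T.dist x₀ (ξ.1 k) ≤ T.dist x₀ (ρ (u k) x₀) + T.dist (ρ (u k) x₀) (ξ.1 k) :=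
      hT.connected.dist_triangle
    rw [dist_ray hT] at h2
    have h3 := hu k
    omega
  obtain ⟨ω, hω⟩ := exists_infWord_of_coarse_path u L hstep htop
  obtain ⟨D, hD⟩ := hbound (2 * L)
  refine ⟨ω, fun k => ?_⟩
  -- The prefix orbit point is within `D` of the orbit point of `u m`, itself within `R` of `ξ.1 m`.
  -- Taking `m > k + (R + D)` makes its geodesic from `x₀` pass through `ξ.1 k`.
  filter_upwards [hω (k + (R + D) + 1)] with n ⟨m, hm, hmn⟩
  refine dist_add_dist_of_near_ray hT ξ (m := m) (C := R + D) (by omega) ?_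
  rw [← lift_prefixProd]
  refine (hT.connected.dist_triangle (v := ρ (u m) x₀)).trans (Nat.add_le_add ?_ ?_)
  · rw [T.dist_comm]
    exact hu m
  · exact (hdist _ _).trans_le (hD _ hmn)

theorem IsFreeQuotient.cylinder_nil [Finite V] [Finite E] {g : ℕ} (hT : T.IsTree)
    {s : Fin g → (T ≃g T)} (hs : Function.Injective (FreeGroup.lift s))
    (h : IsFreeQuotient T (Subgroup.closure (Set.range s)) X p q) (x₀ : W) :
    cylinder (treeCodes (x₀ := x₀) s) [] = Set.univ := by
  refine Set.eq_univ_of_forall fun ξ => ?_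
  obtain ⟨ω, hω⟩ := h.exists_treeCodes hT hs ξ
  exact ⟨ω, fun i => i.elim0, hω⟩

end FreeQuotient

end CantorTriple

end

theorem mainTheorem6 :
    (∀ (g : ℕ) (_ : 2 ≤ g) (γ : Fin g → SL(2, ℂ)) (_ : IsSchottky γ)
      (x₀ : Hyp3) (μ : Measure (limitSet (Subgroup.closure (Set.range γ))))
      [IsProbabilityMeasure μ] (_ : IsSchottkyPS (Subgroup.closure (Set.range γ)) x₀ μ),
      ¬ AdmitsEvenStructure μ (cylinder (schottkyCodes γ))) ∧
    (∀ {V E W : Type*} [Finite V] [Finite E] (g : ℕ) (_ : 2 ≤ g)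
      (X : MultiGraph V E) (_ : X.Connected) (_ : X.betti = g) (_ : ∀ v, 3 ≤ X.valency v)
      (T : SimpleGraph W) (_ : T.IsTree) (s : Fin g → (T ≃g T))
      (_ : Function.Injective (FreeGroup.lift s)) (p : W → V) (q : T.Dart → E)
      (_ : IsFreeQuotient T (Subgroup.closure (Set.range s)) X p q)
      (x₀ : W) (μ : Measure (TreeBoundary T x₀)) [IsProbabilityMeasure μ]
      (_ : IsTreePS (Subgroup.closure (Set.range s)) μ),
      ¬ AdmitsEvenStructure μ (cylinder (treeCodes (x₀ := x₀) s))) := by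
  refine ⟨fun g hg γ hγ x₀ μ _ _ => ?_, fun g _ X _ _ _ T hT s hs p q h x₀ μ _ _ => ?_⟩
  · exact not_admitsEvenStructure _ μ (hγ.cylinder_nil hg)
  · exact not_admitsEvenStructure _ μ (h.cylinder_nil hT hs x₀)
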